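/- Assume the Riemann hypothesis. Let $Z(t)=e^{i\vartheta(t)}\zeta(\tfrac12+it)$ be the (real-valued) Hardy function, where $\vartheta(t)=\operatorname{Im}\log\Gamma(\tfrac14+\tfrac{it}{2})-\tfrac t2\log\pi$ is the Riemann–Siegel theta function ($\log\Gamma$ continued continuously from its real value at $t=0$). Let $0<\gamma'<\gamma''$ be the ordinates of two neighboring zeros of $\zeta$, i.e. $\zeta(\tfrac12+i\gamma')=\zeta(\tfrac12+i\gamma'')=0$ and $\zeta(\tfrac12+it)\neq0$ for $\gamma'<t<\gamma''$. Then $Z$ is differentiable and non-zero at every point of $(\gamma',\gamma'')$, and the function $Z'(t)/Z(t)$ is strictly decreasing on the interval $(\gamma',\gamma'')$. -/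

import Mathlib

open Complex Set

/-- The Riemann-Siegel theta function
`ϑ(t) = Im log Γ(1/4 + it/2) - (t/2) log π`, where `log Γ(1/4 + it/2)` is the branch that is
continuous in `t` and real at `t = 0`. The imaginary part of this branch is the integral from `0`
to `t` of `Im (d/du log Γ(1/4 + iu/2)) = Re ψ(1/4 + iu/2) / 2`, with `ψ = Γ'/Γ`. -/
noncomputable def riemannSiegelTheta (t : ℝ) : ℝ :=
  (∫ u in (0 : ℝ)..t, (Complex.digamma (1 / 4 + (u / 2 : ℝ) * I)).re / 2) - t / 2 * Real.log Real.pi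

/-- The Hardy function `Z(t) = e^{iϑ(t)} ζ(1/2 + it)`, as a real-valued function of the real
variable `t`. The product is real for real `t` (see `ofReal_hardyZ`), so that taking the real part
loses nothing. -/
noncomputable def hardyZ (t : ℝ) : ℝ :=
  (Complex.exp (riemannSiegelTheta t * I) * riemannZeta (1 / 2 + t * I)).re

/-- `a < b` are the ordinates of neighboring zeros of `ζ` on the critical line. -/
structure IsNeighboringZeros (a b : ℝ) : Prop where
  lt : a < b
  zero_left : riemannZeta (1 / 2 + a * I) = 0
  zero_right : riemannZeta (1 / 2 + b * I) = 0
  ne_zero : ∀ t ∈ Ioo a b, riemannZeta (1 / 2 + t * I) ≠ 0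

lemma quarter_ne_neg_nat (t : ℝ) (m : ℕ) : (1 / 4 + (t / 2 : ℝ) * I : ℂ) ≠ -m := by
  intro h
  have := congrArg Complex.re h
  simp at this
  have hm : (0 : ℝ) ≤ m := m.cast_nonneg
  norm_num at this
  linarith

lemma hasDerivAt_Gamma_quarter (t : ℝ) :
    HasDerivAt (fun u : ℝ => Gamma (1 / 4 + (u / 2 : ℝ) * I))
      (Gamma (1 / 4 + (t / 2 : ℝ) * I) * (digamma (1 / 4 + (t / 2 : ℝ) * I) * (I / 2))) t := by
  have h1 := (differentiableAt_Gamma _ (quarter_ne_neg_nat t)).hasDerivAt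
  have h2 : HasDerivAt (fun u : ℝ => (1 / 4 + (u / 2 : ℝ) * I : ℂ)) (I / 2) t := by
    have := ((hasDerivAt_id t).div_const 2).ofReal_comp.mul_const I |>.const_add (1 / 4 : ℂ)
    refine this.congr_deriv ?_
    push_cast
    ring
  have h3 := HasDerivAt.comp t h1 h2
  refine h3.congr_deriv ?_
  have := Gamma_ne_zero (quarter_ne_neg_nat t)
  rw [digamma_def, logDeriv_apply, ← mul_assoc, mul_div_cancel₀ _ this]

lemma continuous_digamma_quarter :
    Continuous (fun u : ℝ => digamma (1 / 4 + (u / 2 : ℝ) * I)) := by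
  have hU : IsOpen {z : ℂ | 0 < z.re} := isOpen_lt continuous_const continuous_re
  have hne : ∀ z ∈ {z : ℂ | 0 < z.re}, ∀ m : ℕ, z ≠ -m := by
    intro z hz m h
    have hm : (0 : ℝ) ≤ m := m.cast_nonneg
    have := congrArg Complex.re h
    simp at this hz
    linarith
  have hd : DifferentiableOn ℂ Gamma {z : ℂ | 0 < z.re} := fun z hz =>
    (differentiableAt_Gamma z (hne z hz)).differentiableWithinAt
  have hc : ContinuousOn digamma {z : ℂ | 0 < z.re} := by
    have h1 : ContinuousOn (deriv Gamma) {z : ℂ | 0 < z.re} := (hd.deriv hU).continuousOn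
    exact h1.div hd.continuousOn (fun z hz => Gamma_ne_zero (hne z hz))
  refine hc.comp_continuous (by fun_prop) (fun u => ?_)
  simp

/-- `e^{iϑ(t)}` is the phase of `π^{-s/2} Γ(s/2)` at `s = 1/2 + it`. -/
theorem exp_riemannSiegelTheta_mul (t : ℝ) :
    Complex.exp (riemannSiegelTheta t * I) * ‖Gammaℝ (1 / 2 + t * I)‖ =
      Gammaℝ (1 / 2 + t * I) := by
  set J : ℝ → ℂ := fun t => ∫ u in (0 : ℝ)..t, digamma (1 / 4 + (u / 2 : ℝ) * I) * (I / 2) with hJ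
  have hcont : Continuous (fun u : ℝ => digamma (1 / 4 + (u / 2 : ℝ) * I) * (I / 2)) :=
    continuous_digamma_quarter.mul continuous_const
  have hJd (x : ℝ) : HasDerivAt J (digamma (1 / 4 + (x / 2 : ℝ) * I) * (I / 2)) x :=
    intervalIntegral.integral_hasDerivAt_right (hcont.intervalIntegrable _ _)
      (hcont.stronglyMeasurableAtFilter _ _) hcont.continuousAt
  have hconst : ∀ x y : ℝ, Gamma (1 / 4 + (x / 2 : ℝ) * I) * Complex.exp (-J x) =
      Gamma (1 / 4 + (y / 2 : ℝ) * I) * Complex.exp (-J y) := by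
    have hd (x : ℝ) : HasDerivAt (fun x : ℝ => Gamma (1 / 4 + (x / 2 : ℝ) * I) *
        Complex.exp (-J x)) 0 x := by
      refine ((hasDerivAt_Gamma_quarter x).mul (hJd x).neg.cexp).congr_deriv ?_
      simp only [Pi.neg_apply]
      ring
    exact is_const_of_deriv_eq_zero (fun x => (hd x).differentiableAt) (fun x => (hd x).deriv)
  have hG : Gamma (1 / 4 + (t / 2 : ℝ) * I) = (Real.Gamma (1 / 4) : ℝ) * Complex.exp (J t) := by
    have h := hconst t 0
    have h0 : J 0 = 0 := by simp [hJ]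
    have h4 : Gamma (1 / 4 : ℂ) = (Real.Gamma (1 / 4) : ℝ) := by
      rw [← Complex.Gamma_ofReal]; norm_num
    rw [h0] at h
    simp only [zero_div, ofReal_zero, zero_mul, add_zero, neg_zero, Complex.exp_zero, mul_one] at h
    rw [← h4, ← h, mul_assoc, ← Complex.exp_add]
    simp
  have hJim : (J t).im = ∫ u in (0 : ℝ)..t, (digamma (1 / 4 + (u / 2 : ℝ) * I)).re / 2 := by
    have := (Complex.imCLM.intervalIntegral_comp_comm (hcont.intervalIntegrable (μ := MeasureTheory.volume) 0 t))
    simp only [Complex.imCLM_apply] at this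
    rw [hJ, ← this]
    refine intervalIntegral.integral_congr (fun u _ => ?_)
    simp [Complex.mul_im]
    ring
  have hpi : (Real.pi : ℂ) ^ (-(1 / 2 + t * I : ℂ) / 2) =
      Complex.exp ((Real.log Real.pi * (-1 / 4) : ℝ) + (-(t / 2 * Real.log Real.pi) : ℝ) * I) := by
    rw [Complex.cpow_def_of_ne_zero (by exact_mod_cast Real.pi_ne_zero),
      ← Complex.ofReal_log Real.pi_pos.le]
    congr 1
    push_cast
    ring
  have hmain : Gammaℝ (1 / 2 + t * I) =
      (Real.Gamma (1 / 4) * Real.exp (Real.log Real.pi * (-1 / 4) + (J t).re) : ℝ) *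
        Complex.exp (riemannSiegelTheta t * I) := by
    have harg : (1 / 2 + t * I : ℂ) / 2 = 1 / 4 + (t / 2 : ℝ) * I := by push_cast; ring
    rw [Gammaℝ_def, harg, hG, hpi, riemannSiegelTheta, ← hJim]
    push_cast
    rw [mul_left_comm, ← Complex.exp_add, mul_assoc, ← Complex.exp_add]
    congr 2
    conv_lhs => rw [← Complex.re_add_im (J t)]
    ring
  have hpos : 0 < Real.Gamma (1 / 4) * Real.exp (Real.log Real.pi * (-1 / 4) + (J t).re) :=
    mul_pos (Real.Gamma_pos_of_pos (by norm_num)) (Real.exp_pos _)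
  rw [hmain, norm_mul, Complex.norm_exp_ofReal_mul_I, Complex.norm_real,
    Real.norm_of_nonneg hpos.le, mul_one, mul_comm]

/-- `e^{iϑ(t)} ζ(1/2 + it)` is real, hence equal to `Z(t)`. -/
theorem ofReal_hardyZ (t : ℝ) :
    (hardyZ t : ℂ) = Complex.exp (riemannSiegelTheta t * I) * riemannZeta (1 / 2 + t * I) := by
  set s : ℂ := 1 / 2 + t * I with hs
  have hsre : s.re = 1 / 2 := by simp [hs]
  have hs0 : s ≠ 0 := by intro h; rw [h] at hsre; norm_num at hsre
  have hGne : Gammaℝ s ≠ 0 := Gammaℝ_ne_zero_of_re_pos (by rw [hsre]; norm_num)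
  have hconj : (starRingEnd ℂ) s = 1 - s := by
    apply Complex.ext
    · simp [hsre]; norm_num
    · simp
  have hs1 : 1 - s ≠ 0 := by
    rw [← hconj]; simpa using hs0
  have hGre' : Gammaℝ (1 - s) ≠ 0 := Gammaℝ_ne_zero_of_re_pos (by simp [hsre]; norm_num)
  have hGconj : (starRingEnd ℂ) (Gammaℝ s) = Gammaℝ ((starRingEnd ℂ) s) := by
    have harg : (Real.pi : ℂ).arg ≠ Real.pi := by
      rw [Complex.arg_ofReal_of_nonneg Real.pi_pos.le]; exact Real.pi_pos.ne
    have hp := Complex.cpow_conj (Real.pi : ℂ) (-s / 2) harg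
    rw [Complex.conj_ofReal] at hp
    rw [Gammaℝ_def, Gammaℝ_def, map_mul, ← Complex.Gamma_conj, ← hp, map_div₀, map_div₀,
      map_neg, Complex.conj_ofNat]
  have hreal : (starRingEnd ℂ) (Gammaℝ s * riemannZeta s) = Gammaℝ s * riemannZeta s := by
    rw [map_mul, hGconj, ← riemannZeta_conj, hconj, riemannZeta_def_of_ne_zero hs0,
      riemannZeta_def_of_ne_zero hs1, completedRiemannZeta_one_sub]
    field_simp
  have hE := exp_riemannSiegelTheta_mul t
  rw [← hs] at hE
  have hn : (‖Gammaℝ s‖ : ℂ) ≠ 0 := by exact_mod_cast norm_ne_zero_iff.mpr hGne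
  have hEq : Complex.exp (riemannSiegelTheta t * I) * riemannZeta s =
      Gammaℝ s * riemannZeta s / ‖Gammaℝ s‖ := by
    rw [eq_div_iff hn, mul_right_comm, hE]
  unfold hardyZ
  rw [← hs]
  apply Complex.conj_eq_iff_re.mp
  rw [hEq, map_div₀, hreal, Complex.conj_ofReal]

/-! Since Z'/Z is the derivative of log |Z|, the claim is strict concavity of log |Z| between the
two zeros. Here |Z(t)| = |ξ(1/2+it)| / ((t² + 1/4) |Γ_ℝ(1/2+it)|). Under RH the numerator is
log-concave between zeros, but -log(t² + 1/4) is convex for t > 1/2. The zeros ±γ₁ compensate: in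
ξ(1/2+z) = (z² + γ₁²) G(z), the factor t² - γ₁² contributes at most -2/t² to the second derivative.
`log_hardyZ_eq` splits log |Z| into log |G(it)|, an elementary part that is strictly concave for t >
γ₁ (`strictConcaveOn_log_sq_sub_sq`), a Gamma part that is concave for t > 0
(`concaveOn_log_sub_log_norm_Gamma`), and a constant.

Concavity of log |G(it)| is obtained without a product over zeros. For small h > 0, RH makes
G(z-h)/G(z+h) holomorphic on the closed right half-plane, and the symmetries of ξ give it modulus 1
on the imaginary axis. Phragmén–Lindelöf bounds it by 1 throughout (`norm_sub_le_norm_add`). So |G|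
grows horizontally: Re G'/G is nonnegative right of the axis and zero on it. Hence Re (G'/G)' ≥ 0 on
the axis, and this is minus the second derivative of log |G(it)|. The growth hypotheses come from a
polynomial upper bound for ξ on strips, an exponential lower bound by Borel–Carathéodory
(`exists_exp_neg_le_norm_riemannXi`), and a direct comparison far to the right
(`exists_norm_riemannXi_sub_le`). -/

/-! ### The function ξ: symmetries and zeros. -/

/-- The entire Riemann xi function, normalised so that `ξ(s) = s (s - 1) Λ(s)`. -/
noncomputable def riemannXi (s : ℂ) : ℂ := s * (s - 1) * completedRiemannZeta₀ s + 1

lemma differentiable_riemannXi : Differentiable ℂ riemannXi := by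
  have := differentiable_completedZeta₀
  unfold riemannXi
  fun_prop

lemma riemannXi_one_sub (s : ℂ) : riemannXi (1 - s) = riemannXi s := by
  rw [riemannXi, riemannXi, completedRiemannZeta₀_one_sub]
  ring

lemma riemannXi_one : riemannXi 1 = 1 := by simp [riemannXi]

lemma riemannXi_eq_mul_zeta {s : ℂ} (hs : 0 < s.re) (hs1 : s ≠ 1) :
    riemannXi s = s * (s - 1) * Gammaℝ s * riemannZeta s := by
  have hs0 : s ≠ 0 := by rintro rfl; simp at hs
  have h1 : 1 - s ≠ 0 := sub_ne_zero.mpr hs1.symm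
  rw [riemannZeta_def_of_ne_zero hs0, mul_assoc _ (Gammaℝ s),
    mul_div_cancel₀ _ (Gammaℝ_ne_zero_of_re_pos hs), completedRiemannZeta_eq, riemannXi]
  field_simp
  ring

lemma Gammaℝ_conj (s : ℂ) :
    Gammaℝ ((starRingEnd ℂ) s) = (starRingEnd ℂ) (Gammaℝ s) := by
  have harg : (Real.pi : ℂ).arg ≠ Real.pi := by
    rw [Complex.arg_ofReal_of_nonneg Real.pi_pos.le]; exact Real.pi_pos.ne
  have hp := Complex.cpow_conj (Real.pi : ℂ) (-s / 2) harg
  rw [Complex.conj_ofReal] at hp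
  rw [Gammaℝ_def, Gammaℝ_def, map_mul, ← Complex.Gamma_conj, ← hp, map_div₀, map_div₀,
    map_neg, Complex.conj_ofNat]

/-- The zeta factorisation gives this for Re s > 0; the functional equation carries it to the other
half-plane. -/
lemma riemannXi_conj (s : ℂ) :
    riemannXi ((starRingEnd ℂ) s) = (starRingEnd ℂ) (riemannXi s) := by
  have key : ∀ s : ℂ, 0 < s.re →
      riemannXi ((starRingEnd ℂ) s) = (starRingEnd ℂ) (riemannXi s) := by
    intro s hs
    by_cases hs1 : s = 1
    · simp [hs1, riemannXi_one]
    · have hc : (starRingEnd ℂ) s ≠ 1 := fun h => hs1 (by simpa using congrArg (starRingEnd ℂ) h)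
      rw [riemannXi_eq_mul_zeta hs hs1, riemannXi_eq_mul_zeta (by simpa using hs) hc,
        Gammaℝ_conj, riemannZeta_conj]
      simp
  rcases lt_or_ge 0 s.re with h | h
  · exact key s h
  · have := key (1 - s) (by simp; linarith)
    rwa [map_sub, map_one, riemannXi_one_sub, riemannXi_one_sub] at this

lemma riemannXi_ne_zero_of_half_lt_re (hRH : RiemannHypothesis) {s : ℂ} (hs : 1 / 2 < s.re) :
    riemannXi s ≠ 0 := by
  by_cases hs1 : s = 1
  · simp [hs1, riemannXi_one]
  have hs0 : s ≠ 0 := by rintro rfl; norm_num at hs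
  rw [riemannXi_eq_mul_zeta (by linarith) hs1]
  refine mul_ne_zero (mul_ne_zero (mul_ne_zero hs0 (sub_ne_zero.mpr hs1))
    (Gammaℝ_ne_zero_of_re_pos (by linarith))) fun h => ?_
  have := hRH s h (by
    rintro ⟨n, rfl⟩
    have hn : (0 : ℝ) ≤ n := n.cast_nonneg
    simp at hs
    norm_num at hs
    linarith) hs1
  linarith

/-! ### Upper bounds for ξ on vertical strips. -/

/-- The Mellin transform with convergent integral at the real points `a ≤ b` is bounded
on the closed vertical strip between them. -/
lemma norm_mellin_le_of_mem_strip {f : ℝ → ℂ} {a b : ℝ} (ha : MellinConvergent f a)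
    (hb : MellinConvergent f b) :
    ∃ C, ∀ s : ℂ, a ≤ s.re → s.re ≤ b → ‖mellin f s‖ ≤ C := by
  refine ⟨∫ t in Ioi (0 : ℝ), (‖(t : ℂ) ^ ((a : ℂ) - 1) • f t‖ + ‖(t : ℂ) ^ ((b : ℂ) - 1) • f t‖),
    fun s h1 h2 => ?_⟩
  refine MeasureTheory.norm_integral_le_of_norm_le (ha.norm.add hb.norm) ?_
  refine (MeasureTheory.ae_restrict_iff' measurableSet_Ioi).mpr (.of_forall fun t ht => ?_)
  have ht : 0 < t := ht
  simp only [norm_smul, norm_cpow_eq_rpow_re_of_pos ht, sub_re, ofReal_re, one_re, ← add_mul]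
  refine mul_le_mul_of_nonneg_right ?_ (norm_nonneg _)
  have p1 := Real.rpow_nonneg ht.le (a - 1)
  have p2 := Real.rpow_nonneg ht.le (b - 1)
  rcases le_total t 1 with h | h
  · linarith [Real.rpow_le_rpow_of_exponent_ge ht h (show a - 1 ≤ s.re - 1 by linarith)]
  · linarith [Real.rpow_le_rpow_of_exponent_le h (show s.re - 1 ≤ b - 1 by linarith)]

/-- By definition Λ₀(s) is half the Mellin transform, at s/2, of a modified theta kernel decaying
faster than any power at 0 and ∞, so the integral converges for every s. -/
lemma exists_norm_completedRiemannZeta₀_le (a b : ℝ) :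
    ∃ C, ∀ s : ℂ, a ≤ s.re → s.re ≤ b → ‖completedRiemannZeta₀ s‖ ≤ C := by
  set P := HurwitzZeta.hurwitzEvenFEPair 0
  have hconv (s : ℂ) : MellinConvergent P.f_modif s := by
    have hP := P.isStrongFEPair_toStrongFEPair
    obtain ⟨u, hu⟩ := exists_gt s.re
    obtain ⟨v, hv⟩ := exists_lt s.re
    exact mellinConvergent_of_isBigO_rpow P.hf_modif_int (hP.hf_top _) hu (hP.hf_zero _) hv
  obtain ⟨C, hC⟩ := norm_mellin_le_of_mem_strip (hconv (a / 2 : ℝ)) (hconv (b / 2 : ℝ))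
  refine ⟨C / 2, fun s h1 h2 => ?_⟩
  have h2re : (s / 2).re = s.re / 2 := by simp
  have := hC (s / 2) (by rw [h2re]; linarith) (by rw [h2re]; linarith)
  have e : completedRiemannZeta₀ s = mellin P.f_modif (s / 2) / 2 := rfl
  rw [e, norm_div, norm_ofNat]
  linarith

lemma exists_norm_riemannXi_le (a b : ℝ) :
    ∃ C, 1 ≤ C ∧ ∀ s : ℂ, a ≤ s.re → s.re ≤ b → ‖riemannXi s‖ ≤ C * (1 + ‖s‖) ^ 2 := by
  obtain ⟨C, hC⟩ := exists_norm_completedRiemannZeta₀_le a b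
  refine ⟨|C| + 1, by linarith [abs_nonneg C], fun s h1 h2 => ?_⟩
  have h := (hC s h1 h2).trans (le_abs_self C)
  have h3 : ‖s - 1‖ ≤ ‖s‖ + 1 := by simpa using norm_sub_le s 1
  calc ‖riemannXi s‖ ≤ ‖s * (s - 1) * completedRiemannZeta₀ s‖ + ‖(1 : ℂ)‖ := norm_add_le _ _
    _ = ‖s‖ * ‖s - 1‖ * ‖completedRiemannZeta₀ s‖ + 1 := by simp
    _ ≤ (1 + ‖s‖) * (‖s‖ + 1) * |C| + 1 := by gcongr; linarith
    _ ≤ _ := by nlinarith [norm_nonneg s, abs_nonneg C]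

/-! ### Bounds for Gamma and zeta. -/

/-- For Re s ≥ 1 the factor x^(s-1) has modulus at most 1, leaving ∫ (1-x)^(h-1) = 1/h. -/
lemma norm_betaIntegral_le {s : ℂ} {h : ℝ} (hs : 1 ≤ s.re) (hh : 0 < h) :
    ‖betaIntegral s h‖ ≤ 1 / h := by
  have hev := betaIntegral_eval_one_right (u := (h : ℂ)) (by simpa)
  have hconv := betaIntegral_convergent (u := (1 : ℂ)) (v := (h : ℂ)) (by simp) (by simpa)
  have hval : ∫ x in (0 : ℝ)..1, ‖(x : ℂ) ^ ((1 : ℂ) - 1) * (1 - (x : ℂ)) ^ ((h : ℂ) - 1)‖ =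
      1 / h := by
    have e : ∀ x ∈ uIoo (0 : ℝ) 1, ‖(x : ℂ) ^ ((1 : ℂ) - 1) * (1 - (x : ℂ)) ^ ((h : ℂ) - 1)‖ =
        (1 - x) ^ (h - 1) := by
      intro x hx
      rw [uIoo_of_le zero_le_one] at hx
      have h1 : (1 - (x : ℂ)) = ((1 - x : ℝ) : ℂ) := by push_cast; ring
      rw [sub_self, cpow_zero, one_mul, h1, norm_cpow_eq_rpow_re_of_pos (by linarith [hx.2])]
      simp
    rw [intervalIntegral.integral_congr_uIoo e,
      intervalIntegral.integral_comp_sub_left (fun x => x ^ (h - 1)) 1]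
    rw [integral_rpow (Or.inl (by linarith))]
    simp [hh.ne']
  rw [← hval, betaIntegral]
  refine intervalIntegral.norm_integral_le_of_norm_le zero_le_one ?_ hconv.norm
  refine .of_forall fun x hx => ?_
  rw [norm_mul, norm_mul, norm_cpow_eq_rpow_re_of_pos hx.1, sub_self, cpow_zero, norm_one]
  refine mul_le_mul_of_nonneg_right ?_ (norm_nonneg _)
  exact Real.rpow_le_one hx.1.le hx.2 (by simpa)

/-- `Γ(s) / Γ(s + h)` is bounded on the half-plane `1 ≤ Re s`. -/
lemma norm_Gamma_le_mul_norm_Gamma_add {s : ℂ} {h : ℝ} (hs : 1 ≤ s.re) (hh : 0 < h) :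
    ‖Gamma s‖ ≤ 1 / (h * Real.Gamma h) * ‖Gamma (s + h)‖ := by
  have hB := Gamma_mul_Gamma_eq_betaIntegral (s := s) (t := (h : ℂ)) (by linarith) (by simpa)
  have hG := Real.Gamma_pos_of_pos hh
  have := congrArg norm hB
  rw [norm_mul, norm_mul, Gamma_ofReal, norm_real, Real.norm_of_nonneg hG.le] at this
  have hle := mul_le_mul_of_nonneg_left (norm_betaIntegral_le hs hh) (norm_nonneg (Gamma (s + h)))
  rw [← this] at hle
  rw [one_div, mul_inv, mul_comm, ← mul_assoc, mul_comm, ← div_eq_inv_mul, le_div_iff₀ hG]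
  simpa [div_eq_mul_inv, mul_comm] using hle

lemma norm_riemannZeta_sub_one_le {s : ℂ} (hs : 2 ≤ s.re) : ‖riemannZeta s - 1‖ ≤ 2 / 3 := by
  have hsum : Summable (fun n : ℕ => 1 / (n + 1 : ℂ) ^ s) := by
    have := (Complex.summable_one_div_nat_cpow (p := s)).mpr (by linarith)
    simpa using (summable_nat_add_iff 1).mpr this
  have hz : HasSum (fun n : ℕ => 1 / (n : ℝ) ^ 2) (Real.pi ^ 2 / 6) := hasSum_zeta_two
  have hz2 : HasSum (fun n : ℕ => 1 / ((n + 2 : ℕ) : ℝ) ^ 2) (Real.pi ^ 2 / 6 - 1) := by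
    have := (hasSum_nat_add_iff' 2).mpr hz
    simpa [Finset.sum_range_succ] using this
  rw [zeta_eq_tsum_one_div_nat_add_one_cpow (by linarith), hsum.tsum_eq_zero_add]
  simp only [Nat.cast_zero, zero_add, one_cpow, div_one, add_sub_cancel_left]
  refine (tsum_of_norm_bounded hz2 fun n => ?_).trans ?_
  · have h1 : ((n + 1 : ℕ) + 1 : ℂ) = ((n + 2 : ℝ) : ℂ) := by push_cast; ring
    have hn : (0 : ℝ) ≤ n := n.cast_nonneg
    rw [h1, norm_div, norm_one, norm_cpow_eq_rpow_re_of_pos (by positivity)]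
    push_cast
    rw [← Real.rpow_natCast]
    refine one_div_le_one_div_of_le (by positivity) ?_
    exact Real.rpow_le_rpow_of_exponent_le (by linarith) (by simpa)
  · nlinarith [Real.pi_lt_d2, Real.pi_pos]

lemma norm_riemannZeta_le {s : ℂ} (hs : 2 ≤ s.re) : ‖riemannZeta s‖ ≤ 2 := by
  have := norm_add_le (riemannZeta s - 1) 1
  have h := norm_riemannZeta_sub_one_le hs
  simp at this
  linarith

lemma le_norm_riemannZeta {s : ℂ} (hs : 2 ≤ s.re) : 1 / 3 ≤ ‖riemannZeta s‖ := by
  have := norm_sub_norm_le (1 : ℂ) (riemannZeta s)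
  have h := norm_riemannZeta_sub_one_le hs
  rw [norm_sub_rev] at h
  simp at this
  linarith

/-- The reflection formula at iy gives |Γ(1+iy)|² = π|y| / |sin(πiy)|, and the sine is at most
e^(π|y|). -/
lemma exp_neg_le_norm_Gamma_one_add_mul_I {y : ℝ} (hy : 1 ≤ |y|) :
    Real.exp (-(Real.pi * |y|)) ≤ ‖Gamma (1 + y * I)‖ := by
  have hy0 : y ≠ 0 := by rintro rfl; norm_num at hy
  have hyI : (y * I : ℂ) ≠ 0 := by simp [hy0]
  have h1 := Complex.Gamma_mul_Gamma_one_sub (y * I)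
  have h2 : ‖Gamma (1 - y * I)‖ = ‖Gamma (1 + y * I)‖ := by
    have : (1 - y * I : ℂ) = (starRingEnd ℂ) (1 + y * I) := by simp [sub_eq_add_neg]
    rw [this, Gamma_conj, norm_conj]
  have h3 : Gamma (1 + y * I) = y * I * Gamma (y * I) := by rw [add_comm, Gamma_add_one _ hyI]
  have h4 : ‖Gamma (1 + y * I)‖ ^ 2 = |y| * Real.pi / ‖sin (Real.pi * (y * I))‖ := by
    rw [sq]
    nth_rw 2 [← h2]
    rw [← norm_mul, h3, mul_assoc, h1]
    simp [abs_of_pos Real.pi_pos, mul_div_assoc]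
  have h5 : ‖sin (Real.pi * (y * I))‖ ≤ Real.exp (Real.pi * |y|) := by
    have e1 : ‖exp (-(Real.pi * (y * I)) * I)‖ ≤ Real.exp (Real.pi * |y|) := by
      rw [norm_exp, Real.exp_le_exp]
      simp
      exact mul_le_mul_of_nonneg_left (le_abs_self y) Real.pi_pos.le
    have e2 : ‖exp (Real.pi * (y * I) * I)‖ ≤ Real.exp (Real.pi * |y|) := by
      rw [norm_exp, Real.exp_le_exp]
      simp
      rw [← mul_neg]
      exact mul_le_mul_of_nonneg_left (neg_le_abs y) Real.pi_pos.le
    rw [Complex.sin, norm_div, norm_mul, norm_I, mul_one, norm_ofNat, div_le_iff₀ two_pos]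
    exact (norm_sub_le _ _).trans (by linarith)
  have h6 : Real.exp (-(Real.pi * |y|)) ≤ ‖Gamma (1 + y * I)‖ ^ 2 := by
    have hspos : 0 < ‖sin (Real.pi * (y * I))‖ := by
      rw [norm_pos_iff]
      intro h0
      rw [h0, norm_zero, div_zero] at h4
      exact Gamma_ne_zero_of_re_pos (s := 1 + y * I) (by simp) (by simpa using h4)
    rw [h4, Real.exp_neg, ← one_div]
    refine div_le_div₀ (by positivity) ?_ hspos h5
    nlinarith [Real.pi_gt_three]
  have h7 : Real.exp (-(Real.pi * |y|)) ≤ 1 := Real.exp_le_one_iff.mpr (by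
    have := Real.pi_pos; nlinarith [abs_nonneg y])
  -- Since e^(-π|y|) ≤ 1, a lower bound for the square by this number is also one for the norm.
  by_contra! hlt
  nlinarith [norm_nonneg (Gamma (1 + y * I)), Real.exp_pos (-(Real.pi * |y|))]

/-! ### Lower bounds for zero-free functions and for ξ. -/

lemma exists_exp_eq_on_ball {g : ℂ → ℂ} {R : ℝ} (hR : 0 < R)
    (hg : DifferentiableOn ℂ g (Metric.ball 0 R)) (h0 : ∀ z ∈ Metric.ball 0 R, g z ≠ 0) :
    ∃ f : ℂ → ℂ, DifferentiableOn ℂ f (Metric.ball 0 R) ∧ f 0 = 0 ∧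
      ∀ z ∈ Metric.ball 0 R, g z = g 0 * exp (f z) := by
  have hlog : DifferentiableOn ℂ (fun z => deriv g z / g z) (Metric.ball 0 R) :=
    (hg.deriv Metric.isOpen_ball).div hg h0
  obtain ⟨f, hf0, hf⟩ := hlog.isExactOn_ball.with_val_at 0 0
  refine ⟨f, fun z hz => (hf z hz).differentiableAt.differentiableWithinAt, hf0, ?_⟩
  have hd : ∀ z ∈ Metric.ball (0 : ℂ) R, HasDerivAt (fun z => g z * exp (-f z)) 0 z := by
    intro z hz
    have h1 := (hg.differentiableAt (Metric.isOpen_ball.mem_nhds hz)).hasDerivAt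
    refine (h1.mul (hf z hz).neg.cexp).congr_deriv ?_
    have := h0 z hz
    simp only [Pi.neg_apply]
    field_simp
    ring
  intro z hz
  have hconst := (convex_ball (0 : ℂ) R).is_const_of_fderivWithin_eq_zero (𝕜 := ℂ)
    (f := fun z => g z * exp (-f z))
    (fun w hw => (hd w hw).differentiableAt.differentiableWithinAt) (fun w hw => by
      rw [fderivWithin_of_isOpen Metric.isOpen_ball hw]
      ext; simp [(hd w hw).deriv]) hz (Metric.mem_ball_self hR)
  simp only [hf0, neg_zero, exp_zero, mul_one] at hconst
  rw [← hconst, mul_assoc, ← exp_add]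
  simp

/-- A zero-free holomorphic function on a disc is bounded below on smaller concentric discs in
terms of an upper bound `M` on the disc and a lower bound at the centre. -/
lemma le_norm_of_ne_zero_on_ball {g : ℂ → ℂ} {c : ℂ} {r R L m : ℝ} (hrR : r < R)
    (hm : 0 < m) (hL : 0 < L)
    (hg : DifferentiableOn ℂ g (Metric.ball c R)) (h0 : ∀ z ∈ Metric.ball c R, g z ≠ 0)
    (hup : ∀ z ∈ Metric.ball c R, ‖g z‖ ≤ m * Real.exp L) (hlow : m ≤ ‖g c‖) {z : ℂ}
    (hz : ‖z - c‖ ≤ r) :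
    m * Real.exp (-(2 * L * r / (R - r))) ≤ ‖g z‖ := by
  have hr0 : 0 ≤ r := (norm_nonneg _).trans hz
  have hR : 0 < R := by linarith
  have hmem : ∀ w ∈ Metric.ball (0 : ℂ) R, w + c ∈ Metric.ball c R := by
    intro w hw
    simpa [dist_eq_norm] using hw
  obtain ⟨f, hfd, hf0, hf⟩ := exists_exp_eq_on_ball (g := fun w => g (w + c)) hR
    (hg.comp (by fun_prop) hmem) (fun w hw => h0 _ (hmem w hw))
  simp only [zero_add] at hf
  -- The lower bound at the centre turns the upper bound for |g| into Re f ≤ L, as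
  -- Borel–Carathéodory requires.
  have hre : MapsTo f (Metric.ball 0 R) {z | z.re ≤ L} := by
    intro w hw
    have h1 := hup _ (hmem w hw)
    rw [hf w hw, norm_mul, norm_exp] at h1
    have h2 : m * Real.exp (f w).re ≤ m * Real.exp L :=
      (mul_le_mul_of_nonneg_right hlow (Real.exp_pos _).le).trans h1
    exact Real.exp_le_exp.mp (le_of_mul_le_mul_left h2 hm)
  have hzR : z - c ∈ Metric.ball (0 : ℂ) R := by
    rw [mem_ball_zero_iff]; linarith
  have hb := borelCaratheodory_zero hL hfd hre hR hzR hf0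
  have hb2 : 2 * L * ‖z - c‖ / (R - ‖z - c‖) ≤ 2 * L * r / (R - r) := by
    gcongr
  have h3 : -(2 * L * r / (R - r)) ≤ (f (z - c)).re := by
    have := neg_le_of_abs_le ((abs_re_le_norm (f (z - c))).trans (hb.trans hb2))
    linarith
  have h4 := hf _ hzR
  rw [sub_add_cancel] at h4
  rw [h4, norm_mul, norm_exp]
  gcongr

lemma sq_le_two_mul_exp {x : ℝ} (hx : 0 ≤ x) : x ^ 2 ≤ 2 * Real.exp x := by
  have := Real.quadratic_le_exp_of_nonneg hx
  nlinarith

lemma exp_neg_le_norm_riemannXi_four_add {t : ℝ} (ht : 2 ≤ |t|) :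
    Real.exp (-(10 + 2 * |t|)) ≤ ‖riemannXi (4 + t * I)‖ := by
  have hre : (4 + t * I : ℂ).re = 4 := by simp
  have h1 : (4 + t * I : ℂ) ≠ 1 := fun h => by
    have := congrArg re h
    rw [hre] at this
    norm_num at this
  have hn1 : 1 ≤ ‖(4 + t * I : ℂ)‖ := by
    have := abs_re_le_norm (4 + t * I : ℂ)
    rw [hre] at this
    norm_num at this
    linarith
  have hn2 : 1 ≤ ‖(4 + t * I - 1 : ℂ)‖ := by
    have := abs_re_le_norm (4 + t * I - 1 : ℂ)
    rw [sub_re, hre] at this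
    norm_num at this
    linarith
  have hz := le_norm_riemannZeta (s := 4 + t * I) (by rw [hre]; norm_num)
  have hG := exp_neg_le_norm_Gamma_one_add_mul_I (y := t / 2) (by
    rw [abs_div, abs_two]; linarith)
  have hG2 : ‖Gamma (1 + (t / 2 : ℝ) * I)‖ ≤ ‖Gamma ((4 + t * I) / 2)‖ := by
    have e : (4 + t * I : ℂ) / 2 = (1 + (t / 2 : ℝ) * I) + 1 := by push_cast; ring
    have hne : (1 + (t / 2 : ℝ) * I : ℂ) ≠ 0 := fun h => by simpa using congrArg re h
    rw [e, Gamma_add_one _ hne, norm_mul]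
    refine le_mul_of_one_le_left (norm_nonneg _) ?_
    simpa using abs_re_le_norm (1 + (t / 2 : ℝ) * I)
  have hpi : ‖(Real.pi : ℂ) ^ (-(4 + t * I) / 2)‖ = 1 / Real.pi ^ 2 := by
    rw [norm_cpow_eq_rpow_re_of_pos Real.pi_pos]
    have : (-(4 + t * I : ℂ) / 2).re = -2 := by simp; norm_num
    rw [this, Real.rpow_neg Real.pi_pos.le, one_div]
    norm_cast
  rw [riemannXi_eq_mul_zeta (by rw [hre]; norm_num) h1, Gammaℝ_def]
  simp only [norm_mul, hpi]
  have hpi2 : 1 / 16 ≤ 1 / Real.pi ^ 2 := by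
    refine one_div_le_one_div_of_le (by positivity) ?_
    nlinarith [Real.pi_lt_d2, Real.pi_pos]
  -- 48 = 16 · 3, from π² ≤ 16 and |ζ| ≥ 1/3.
  have hexp : Real.exp (-(10 + 2 * |t|)) ≤ 1 / 48 * Real.exp (-(Real.pi * |t / 2|)) := by
    have h48 : Real.exp (-10) ≤ 1 / 48 := by
      rw [Real.exp_neg, ← one_div]
      refine one_div_le_one_div_of_le (by norm_num) ?_
      have := Real.quadratic_le_exp_of_nonneg (x := 10) (by norm_num)
      linarith
    rw [neg_add, Real.exp_add]
    refine mul_le_mul h48 (Real.exp_le_exp.mpr ?_) (Real.exp_pos _).le (by norm_num)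
    rw [abs_div, abs_two]
    nlinarith [Real.pi_lt_d2, abs_nonneg t]
  calc _ ≤ 1 / 48 * Real.exp (-(Real.pi * |t / 2|)) := hexp
    _ = 1 * 1 * (1 / 16 * Real.exp (-(Real.pi * |t / 2|))) * (1 / 3) := by ring
    _ ≤ _ := by
      gcongr
      exact hG.trans hG2

/-- The disc of radius 7/2 about 4 + i Im s is tangent to the critical line, so it is zero-free
under RH, and s lies within 7/2 - h of its centre. -/
lemma exists_exp_neg_le_norm_riemannXi (hRH : RiemannHypothesis) {h : ℝ} (hh : 0 < h)
    (hh4 : h ≤ 1 / 4) :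
    ∃ K, 0 ≤ K ∧ ∀ s : ℂ, 1 / 2 + h ≤ s.re → s.re ≤ 4 → 2 ≤ |s.im| →
      Real.exp (-(K * (1 + |s.im|))) ≤ ‖riemannXi s‖ := by
  obtain ⟨C, hC1, hC⟩ := exists_norm_riemannXi_le (1 / 2) 8
  have hlog : 0 ≤ Real.log (2 * C) := Real.log_nonneg (by linarith)
  refine ⟨10 + 7 / h * (Real.log (2 * C) + 19), by positivity, fun s h1 h2 h3 => ?_⟩
  set t := s.im with ht
  -- Chosen so that e^(-(10+2|t|)) e^L = 2C e^(9+|t|), which dominates C(1+|z|)² on the disc, where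
  -- |z| ≤ 8 + |t|.
  set L := Real.log (2 * C) + 19 + 3 * |t| with hL
  have hLpos : 0 < L := by positivity
  have hre : ∀ z ∈ Metric.ball (4 + t * I : ℂ) (7 / 2), 1 / 2 < z.re ∧ z.re ≤ 8 := by
    intro z hz
    rw [mem_ball_iff_norm] at hz
    have := abs_lt.mp ((abs_re_le_norm _).trans_lt hz)
    simp at this
    constructor <;> linarith [this.1, this.2]
  have key := le_norm_of_ne_zero_on_ball (g := riemannXi) (c := 4 + t * I) (r := 7 / 2 - h)
    (R := 7 / 2) (L := L) (m := Real.exp (-(10 + 2 * |t|))) (z := s) (by linarith)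
    (Real.exp_pos _) hLpos differentiable_riemannXi.differentiableOn
    (fun z hz => riemannXi_ne_zero_of_half_lt_re hRH (hre z hz).1) (fun z hz => ?_)
    (exp_neg_le_norm_riemannXi_four_add h3) ?_
  · refine le_trans ?_ key
    rw [← Real.exp_add, Real.exp_le_exp]
    have e : 2 * L * (7 / 2 - h) / (7 / 2 - (7 / 2 - h)) ≤ 7 / h * L := by
      rw [sub_sub_cancel, div_mul_eq_mul_div]
      exact (div_le_div_iff_of_pos_right hh).mpr (by nlinarith)
    have e2 : 7 / h * L ≤ 7 / h * (Real.log (2 * C) + 19) * (1 + |t|) := by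
      rw [mul_assoc]
      gcongr
      nlinarith [abs_nonneg t]
    nlinarith [abs_nonneg t]
  · have hz1 := hC z (hre z hz).1.le (hre z hz).2
    rw [mem_ball_iff_norm] at hz
    have hzn : ‖z‖ ≤ 8 + |t| := by
      have a1 := norm_le_norm_sub_add z (4 + t * I)
      have a2 := norm_add_le (4 : ℂ) (t * I)
      simp at a2
      linarith
    have h9 : (1 + ‖z‖) ^ 2 ≤ 2 * Real.exp (9 + |t|) := by
      refine le_trans ?_ (sq_le_two_mul_exp (by positivity))
      exact pow_le_pow_left₀ (by positivity) (by linarith) 2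
    rw [← Real.exp_add]
    have e : -(10 + 2 * |t|) + L = Real.log (2 * C) + (9 + |t|) := by rw [hL]; ring
    rw [e, Real.exp_add, Real.exp_log (by linarith)]
    nlinarith
  · have e : s - (4 + t * I) = ((s.re - 4 : ℝ) : ℂ) := by
      apply Complex.ext <;> simp [ht]
    rw [e, norm_real, Real.norm_eq_abs, abs_le]
    constructor <;> linarith

/-! ### Comparing ξ(s-h) with ξ(s+h) far to the right. -/

lemma norm_Gammaℝ_le_mul_norm_Gammaℝ_add {s : ℂ} {h : ℝ} (hh : 0 < h) (hs : 2 ≤ s.re) :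
    ‖Gammaℝ s‖ ≤ Real.pi ^ h / (h * Real.Gamma h) * ‖Gammaℝ (s + 2 * h)‖ := by
  have hG := norm_Gamma_le_mul_norm_Gamma_add (s := s / 2) (h := h) (by simp; linarith) hh
  have e1 : (s + 2 * h) / 2 = s / 2 + h := by ring
  have e2 : ‖(Real.pi : ℂ) ^ (-s / 2)‖ = Real.pi ^ h * ‖(Real.pi : ℂ) ^ (-(s + 2 * h) / 2)‖ := by
    rw [norm_cpow_eq_rpow_re_of_pos Real.pi_pos, norm_cpow_eq_rpow_re_of_pos Real.pi_pos,
      ← Real.rpow_add Real.pi_pos]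
    congr 1
    simp
    ring
  rw [Gammaℝ_def, Gammaℝ_def, e1, norm_mul, norm_mul, e2]
  calc _ ≤ Real.pi ^ h * ‖(Real.pi : ℂ) ^ (-(s + 2 * h) / 2)‖ *
        (1 / (h * Real.Gamma h) * ‖Gamma (s / 2 + h)‖) := by gcongr
    _ = _ := by ring

lemma exists_norm_riemannXi_sub_le {h : ℝ} (hh : 0 < h) (hh4 : h ≤ 1 / 4) :
    ∃ C, 0 ≤ C ∧ ∀ s : ℂ, 3 ≤ s.re → ‖riemannXi (s - h)‖ ≤ C * ‖riemannXi (s + h)‖ := by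
  have hGp := Real.Gamma_pos_of_pos hh
  -- 6 is the quotient of the bounds 2 and 1/3 for |ζ|; the rest is the cost of shifting Γ_ℝ by 2h.
  refine ⟨Real.pi ^ h / (h * Real.Gamma h) * 6, by positivity, fun s hs => ?_⟩
  have hne : ∀ w : ℂ, 2 ≤ w.re → w ≠ 1 := by
    rintro w hw rfl
    norm_num at hw
  have r1 : (s - h).re = s.re - h := by simp
  have r2 : (s + h).re = s.re + h := by simp
  have n1 : ‖s - h‖ ≤ ‖s + h‖ := by
    rw [← sq_le_sq₀ (norm_nonneg _) (norm_nonneg _), ← normSq_eq_norm_sq, ← normSq_eq_norm_sq,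
      normSq_apply, normSq_apply]
    simp
    nlinarith
  have n2 : ‖s - h - 1‖ ≤ ‖s + h - 1‖ := by
    rw [← sq_le_sq₀ (norm_nonneg _) (norm_nonneg _), ← normSq_eq_norm_sq, ← normSq_eq_norm_sq,
      normSq_apply, normSq_apply]
    simp
    nlinarith
  have g := norm_Gammaℝ_le_mul_norm_Gammaℝ_add (s := s - h) hh (by rw [r1]; linarith)
  rw [show s - h + 2 * h = s + h by ring] at g
  have z1 := norm_riemannZeta_le (s := s - h) (by rw [r1]; linarith)
  have z2 := le_norm_riemannZeta (s := s + h) (by rw [r2]; linarith)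
  have z3 : ‖riemannZeta (s - h)‖ ≤ 6 * ‖riemannZeta (s + h)‖ := by linarith
  rw [riemannXi_eq_mul_zeta (by rw [r1]; linarith) (hne _ (by rw [r1]; linarith)),
    riemannXi_eq_mul_zeta (by rw [r2]; linarith) (hne _ (by rw [r2]; linarith))]
  simp only [norm_mul]
  calc _ ≤ ‖s + h‖ * ‖s + h - 1‖ * (Real.pi ^ h / (h * Real.Gamma h) * ‖Gammaℝ (s + h)‖) *
        (6 * ‖riemannZeta (s + h)‖) := by gcongr
    _ = _ := by ring

/-! ### Dividing out the zeros ±iγ. -/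

lemma exists_eq_mul_of_two_zeros {F : ℂ → ℂ} (hF : Differentiable ℂ F) {a b : ℂ} (hab : a ≠ b)
    (ha : F a = 0) (hb : F b = 0) :
    ∃ G : ℂ → ℂ, Differentiable ℂ G ∧ ∀ z, F z = (z - a) * (z - b) * G z := by
  have hd : ∀ {F : ℂ → ℂ} (a : ℂ), Differentiable ℂ F → Differentiable ℂ (dslope F a) :=
    fun a hF => differentiableOn_univ.mp
      ((Complex.differentiableOn_dslope Filter.univ_mem).mpr hF.differentiableOn)
  have h1 : ∀ z, F z = (z - a) * dslope F a z := fun z => by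
    have := sub_smul_dslope F a z
    rw [ha, sub_zero, smul_eq_mul] at this
    exact this.symm
  have hb' : dslope F a b = 0 := by
    have := h1 b
    rw [hb] at this
    exact (mul_eq_zero.mp this.symm).resolve_left (sub_ne_zero.mpr hab.symm)
  refine ⟨dslope (dslope F a) b, hd b (hd a hF), fun z => ?_⟩
  have := sub_smul_dslope (dslope F a) b z
  rw [hb', sub_zero, smul_eq_mul] at this
  rw [h1, ← this, mul_assoc]

/-- `G` is the quotient of `ξ(1/2 + z)` by `z² + γ²`. -/
structure IsXiQuotient (γ : ℝ) (G : ℂ → ℂ) : Prop where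
  pos : 0 < γ
  differentiable : Differentiable ℂ G
  eq_mul : ∀ z, riemannXi (1 / 2 + z) = (z ^ 2 + γ ^ 2) * G z

lemma exists_isXiQuotient {γ : ℝ} (hγ : 0 < γ) (h : riemannZeta (1 / 2 + γ * I) = 0) :
    ∃ G, IsXiQuotient γ G := by
  have hne : (γ : ℂ) * I ≠ -(γ * I) := by
    intro h
    have := congrArg im h
    simp at this
    linarith
  have h1 : riemannXi (1 / 2 + γ * I) = 0 := by
    rw [riemannXi_eq_mul_zeta (by simp), h, mul_zero]
    intro h
    have := congrArg im h
    simp at this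
    linarith
  have h2 : riemannXi (1 / 2 + -(γ * I)) = 0 := by
    rw [← riemannXi_one_sub, ← h1]
    congr 1
    ring
  obtain ⟨G, hG, hGe⟩ := exists_eq_mul_of_two_zeros (F := fun z => riemannXi (1 / 2 + z))
    (differentiable_riemannXi.comp (by fun_prop)) hne h1 h2
  refine ⟨G, hγ, hG, fun z => (hGe z).trans ?_⟩
  congr 1
  linear_combination (-γ ^ 2 : ℂ) * I_sq

lemma sq_add_sq_ne_zero {γ : ℝ} {z : ℂ} (hz : z ∉ ({γ * I, -(γ * I)} : Set ℂ)) :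
    z ^ 2 + (γ : ℂ) ^ 2 ≠ 0 := by
  have e : z ^ 2 + (γ : ℂ) ^ 2 = (z - γ * I) * (z - -(γ * I)) := by
    linear_combination (γ ^ 2 : ℂ) * I_sq
  simp only [mem_insert_iff, mem_singleton_iff, not_or] at hz
  rw [e]
  exact mul_ne_zero (sub_ne_zero.mpr hz.1) (sub_ne_zero.mpr hz.2)

namespace IsXiQuotient

variable {γ : ℝ} {G : ℂ → ℂ}

/-- Off ±iγ the factor z² + γ² cancels from the symmetry of ξ; continuity and density give the rest.
-/
lemma neg (hG : IsXiQuotient γ G) (z : ℂ) : G (-z) = G z := by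
  have hc := hG.differentiable.continuous
  refine congrFun (Continuous.ext_on (s := ({γ * I, -(γ * I)} : Set ℂ)ᶜ)
    ((Set.to_countable _).dense_compl ℂ) (hc.comp continuous_neg) hc fun w hw => ?_) z
  have h1 := hG.eq_mul (-w)
  rw [show (1 / 2 + -w : ℂ) = 1 - (1 / 2 + w) by ring, riemannXi_one_sub, hG.eq_mul, neg_sq] at h1
  exact (mul_left_cancel₀ (sq_add_sq_ne_zero hw) h1).symm

lemma conj (hG : IsXiQuotient γ G) (z : ℂ) :
    G ((starRingEnd ℂ) z) = (starRingEnd ℂ) (G z) := by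
  have hc := hG.differentiable.continuous
  refine congrFun (Continuous.ext_on (s := ({γ * I, -(γ * I)} : Set ℂ)ᶜ)
    ((Set.to_countable _).dense_compl ℂ) (hc.comp continuous_conj)
    (continuous_conj.comp hc) fun w hw => ?_) z
  have h1 := hG.eq_mul ((starRingEnd ℂ) w)
  have e : (1 / 2 + (starRingEnd ℂ) w : ℂ) = (starRingEnd ℂ) (1 / 2 + w) := by
    rw [map_add, map_div₀, map_one, conj_ofNat]
  rw [e, riemannXi_conj, hG.eq_mul] at h1
  have e2 : ((starRingEnd ℂ) w) ^ 2 + (γ : ℂ) ^ 2 = (starRingEnd ℂ) (w ^ 2 + γ ^ 2) := by simp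
  rw [e2, map_mul] at h1
  exact (mul_left_cancel₀
    (by simpa using (starRingEnd ℂ).injective.ne (sq_add_sq_ne_zero hw)) h1).symm

lemma norm_neg_conj (hG : IsXiQuotient γ G) (z : ℂ) : ‖G (-(starRingEnd ℂ) z)‖ = ‖G z‖ := by
  rw [hG.neg, hG.conj, norm_conj]

lemma ne_zero (hRH : RiemannHypothesis) (hG : IsXiQuotient γ G) {z : ℂ} (hz : 0 < z.re) :
    G z ≠ 0 := by
  intro h
  refine riemannXi_ne_zero_of_half_lt_re hRH (s := 1 / 2 + z) (by simpa) ?_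
  rw [hG.eq_mul, h, mul_zero]

/-! ### Horizontal monotonicity by Phragmén–Lindelöf. -/

/-- At both z - h and z + h the divided factor is comparable to |z|²: at least |z|²/4 at either
point and at most 4|z|² at z + h, hence 16. -/
lemma norm_div_le (hG : IsXiQuotient γ G) {h : ℝ} (hh : 0 < h) (hh4 : h ≤ 1 / 4) {z : ℂ}
    (hz : 4 + 4 * γ ≤ ‖z‖) :
    ‖G (z - h) / G (z + h)‖ ≤
      16 * (‖riemannXi (1 / 2 + z - h)‖ / ‖riemannXi (1 / 2 + z + h)‖) := by
  have hγ := hG.pos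
  have hhn : ‖(h : ℂ)‖ = h := by rw [norm_real, Real.norm_of_nonneg hh.le]
  have hγn : ‖(γ : ℂ)‖ = γ := by rw [norm_real, Real.norm_of_nonneg hγ.le]
  have lowbd : ∀ w : ℂ, ‖z‖ - 1 / 4 ≤ ‖w‖ → ‖z‖ ^ 2 / 4 ≤ ‖w ^ 2 + (γ : ℂ) ^ 2‖ := by
    intro w hw
    have h1 := norm_sub_le (w ^ 2 + (γ : ℂ) ^ 2) (γ ^ 2)
    rw [add_sub_cancel_right, norm_pow, norm_pow, hγn] at h1
    nlinarith
  have upbd : ∀ w : ℂ, ‖w‖ ≤ ‖z‖ + 1 / 4 → ‖w ^ 2 + (γ : ℂ) ^ 2‖ ≤ 4 * ‖z‖ ^ 2 := by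
    intro w hw
    have h1 := norm_add_le (w ^ 2) ((γ : ℂ) ^ 2)
    rw [norm_pow, norm_pow, hγn] at h1
    nlinarith [norm_nonneg w]
  have n1 : ‖z‖ - 1 / 4 ≤ ‖z - h‖ := by
    have := norm_sub_norm_le z h
    rw [hhn] at this
    linarith
  have n2 : ‖z‖ - 1 / 4 ≤ ‖z + h‖ := by
    have := norm_sub_le_norm_add z h
    rw [hhn] at this
    linarith
  have n3 : ‖z + h‖ ≤ ‖z‖ + 1 / 4 := by
    have := norm_add_le z h
    rw [hhn] at this
    linarith
  have hzp : 0 < ‖z‖ := by linarith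
  have l1 := lowbd _ n1
  have l2 := lowbd _ n2
  have u2 := upbd _ n3
  have p1 : 0 < ‖(z - h) ^ 2 + (γ : ℂ) ^ 2‖ := lt_of_lt_of_le (by positivity) l1
  have p2 : 0 < ‖(z + h) ^ 2 + (γ : ℂ) ^ 2‖ := lt_of_lt_of_le (by positivity) l2
  have e1 : ‖G (z - h)‖ = ‖riemannXi (1 / 2 + z - h)‖ / ‖(z - h) ^ 2 + (γ : ℂ) ^ 2‖ := by
    rw [add_sub_assoc, hG.eq_mul, norm_mul, mul_div_cancel_left₀ _ p1.ne']
  have e2 : ‖G (z + h)‖ = ‖riemannXi (1 / 2 + z + h)‖ / ‖(z + h) ^ 2 + (γ : ℂ) ^ 2‖ := by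
    rw [add_assoc, hG.eq_mul, norm_mul, mul_div_cancel_left₀ _ p2.ne']
  rw [norm_div, e1, e2, div_div_div_eq, mul_comm _ ‖riemannXi (1 / 2 + z + h)‖,
    mul_div_mul_comm, mul_comm]
  refine mul_le_mul_of_nonneg_right ?_ (by positivity)
  rw [div_le_iff₀ p1]
  linarith

lemma exists_norm_div_le_exp (hRH : RiemannHypothesis) (hG : IsXiQuotient γ G) {h : ℝ}
    (hh : 0 < h) (hh4 : h ≤ 1 / 4) :
    ∃ A B : ℝ, 0 ≤ A ∧ (∀ z : ℂ, 4 + 4 * γ ≤ ‖z‖ → 3 ≤ z.re → ‖G (z - h) / G (z + h)‖ ≤ A) ∧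
      ∀ z : ℂ, 6 + 4 * γ ≤ ‖z‖ → 0 ≤ z.re → z.re ≤ 3 →
        ‖G (z - h) / G (z + h)‖ ≤ A * Real.exp (B * ‖z‖) := by
  have hγ := hG.pos
  obtain ⟨C, hC0, hC⟩ := exists_norm_riemannXi_sub_le hh hh4
  obtain ⟨K, hK0, hK⟩ := exists_exp_neg_le_norm_riemannXi hRH hh hh4
  obtain ⟨D, hD1, hD⟩ := exists_norm_riemannXi_le 0 4
  refine ⟨16 * C + 32 * D, 3 + 2 * K, by positivity, fun z hz hz3 => ?_, fun z hz hz0 hz3 => ?_⟩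
  · refine (hG.norm_div_le hh hh4 hz).trans ?_
    have h1 := hC (1 / 2 + z) (by simp; linarith)
    have h2 : ‖riemannXi (1 / 2 + z - h)‖ / ‖riemannXi (1 / 2 + z + h)‖ ≤ C :=
      div_le_of_le_mul₀ (norm_nonneg _) hC0 h1
    linarith
  · refine (hG.norm_div_le hh hh4 (by linarith)).trans ?_
    have hhn : ‖(h : ℂ)‖ = h := by rw [norm_real, Real.norm_of_nonneg hh.le]
    have him : |(1 / 2 + z + h : ℂ).im| = |z.im| := by simp
    -- This is why the strip needs |z| ≥ 6 + 4γ: Re z ≤ 3 then forces a large imaginary part.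
    have him2 : 2 ≤ |z.im| := by
      have := norm_le_abs_re_add_abs_im z
      rw [abs_of_nonneg hz0] at this
      linarith
    have low := hK (1 / 2 + z + h) (by simpa) (by simp; linarith) (by rwa [him])
    have up := hD (1 / 2 + z - h) (by simp; linarith) (by simp; linarith)
    have hn : ‖(1 / 2 + z - h : ℂ)‖ ≤ 1 + ‖z‖ := by
      have a1 := norm_sub_le (1 / 2 + z : ℂ) h
      have a2 := norm_add_le (1 / 2 : ℂ) z
      rw [hhn] at a1
      norm_num at a2
      linarith
    rw [him] at low
    have sqb : (1 + ‖(1 / 2 + z - h : ℂ)‖) ^ 2 ≤ 2 * Real.exp (2 + ‖z‖) :=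
      (pow_le_pow_left₀ (by positivity) (by linarith) 2).trans
        (sq_le_two_mul_exp (by positivity))
    have hzi := abs_im_le_norm z
    calc _ ≤ 16 * (D * (2 * Real.exp (2 + ‖z‖)) / Real.exp (-(K * (1 + |z.im|)))) := by
          gcongr
          exact up.trans (by gcongr)
      _ = 32 * D * Real.exp (2 + ‖z‖ + K * (1 + |z.im|)) := by
          rw [Real.exp_add (2 + ‖z‖), Real.exp_neg, div_inv_eq_mul]
          ring
      _ ≤ (16 * C + 32 * D) * Real.exp ((3 + 2 * K) * ‖z‖) := by
          gcongr
          · linarith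
          · nlinarith

/-- Horizontal monotonicity of `‖G‖`, from the Phragmén–Lindelöf principle. -/
theorem norm_sub_le_norm_add (hRH : RiemannHypothesis) (hG : IsXiQuotient γ G) {h : ℝ}
    (hh : 0 < h) (hh4 : h ≤ 1 / 4) {z : ℂ} (hz : 0 ≤ z.re) : ‖G (z - h)‖ ≤ ‖G (z + h)‖ := by
  obtain ⟨A, B, hA, h1, h2⟩ := hG.exists_norm_div_le_exp hRH hh hh4
  have hne : ∀ w : ℂ, 0 ≤ w.re → G (w + h) ≠ 0 := fun w hw => hG.ne_zero hRH (by simp; linarith)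
  suffices h3 : ‖G (z - h) / G (z + h)‖ ≤ 1 by
    rwa [norm_div, div_le_one (norm_pos_iff.mpr (hne z hz))] at h3
  -- Growth of order 1 is allowed, being below 2; the bound on the positive real axis excludes
  -- behaviour like e^z.
  refine PhragmenLindelof.right_half_plane_of_bounded_on_real
    (f := fun z => G (z - h) / G (z + h)) ?_ ⟨1, by norm_num, |B|, ?_⟩ ?_ ?_ hz
  · refine DifferentiableOn.diffContOnCl fun w hw => ?_
    rw [Complex.closure_setOfPred_lt_re] at hw
    have hd := hG.differentiable
    exact ((hd.comp (by fun_prop : Differentiable ℂ fun z : ℂ => z - h)) w |>.div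
      ((hd.comp (by fun_prop : Differentiable ℂ fun z : ℂ => z + h)) w)
      (hne w hw)).differentiableWithinAt
  · refine Asymptotics.IsBigO.of_bound A ?_
    have hlarge : ∀ᶠ z : ℂ in Bornology.cobounded ℂ, 6 + 4 * γ ≤ ‖z‖ :=
      tendsto_norm_cobounded_atTop.eventually_ge_atTop _
    filter_upwards [hlarge.filter_mono inf_le_left,
      Filter.mem_inf_of_right (Filter.mem_principal_self _)] with w hw hw0
    rw [Real.norm_of_nonneg (Real.exp_pos _).le, Real.rpow_one]
    rcases le_total 3 w.re with h3 | h3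
    · refine (h1 w (by linarith) h3).trans (le_mul_of_one_le_right hA ?_)
      exact Real.one_le_exp (by positivity)
    · refine (h2 w hw (le_of_lt hw0) h3).trans ?_
      gcongr
      exact le_abs_self B
  · refine ⟨A, ?_⟩
    rw [Filter.eventually_map]
    filter_upwards [Filter.eventually_ge_atTop (6 + 4 * γ)] with x hx
    have hγ := hG.pos
    refine h1 x ?_ (by simp; linarith)
    rw [norm_real, Real.norm_of_nonneg (by linarith)]
    linarith
  · intro x
    have e : (x * I - h : ℂ) = -(starRingEnd ℂ) (x * I + h) := by
      simp; ring
    rw [norm_div, e, hG.norm_neg_conj]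
    exact div_self_le_one _

end IsXiQuotient

/-! ### From monotonicity of |G| to concavity on the axis. -/

lemma HasDerivAt.log_norm {f : ℝ → ℂ} {f' : ℂ} {x : ℝ} (hf : HasDerivAt f f' x) (h0 : f x ≠ 0) :
    HasDerivAt (fun t => Real.log ‖f t‖) (f' / f x).re x := by
  have h1 := (hf.norm_sq.log (by simpa using h0)).const_mul (1 / 2)
  have e : (fun t => Real.log ‖f t‖) = fun t => 1 / 2 * Real.log (‖f t‖ ^ 2) := by
    ext t
    rw [Real.log_pow]
    push_cast
    ring
  rw [e]
  refine h1.congr_deriv ?_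
  rw [div_re, ← normSq_eq_norm_sq]
  have : normSq (f x) ≠ 0 := by simpa using h0
  simp only [real_inner_eq_re_inner, RCLike.inner_apply]
  field_simp
  simp

lemma HasDerivAt.nonneg_of_forall_right {f : ℝ → ℝ} {d ε x : ℝ} (hf : HasDerivAt f d x)
    (hε : 0 < ε) (h : ∀ h, 0 < h → h ≤ ε → f x ≤ f (x + h)) : 0 ≤ d := by
  have h1 := hasDerivWithinAt_iff_tendsto_slope' (s := Ioi x) (by simp) |>.mp
    hf.hasDerivWithinAt
  refine ge_of_tendsto h1 ?_
  filter_upwards [Ioc_mem_nhdsGT (show x < x + ε by linarith)] with y hy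
  have := h (y - x) (by linarith [hy.1]) (by linarith [hy.2])
  rw [add_sub_cancel] at this
  rw [slope_def_field]
  exact div_nonneg (by linarith) (by linarith [hy.1])

namespace IsXiQuotient

variable {γ : ℝ} {G : ℂ → ℂ}

lemma hasDerivAt_log_norm_add (hG : IsXiQuotient γ G) (z : ℂ) (x : ℝ) (h0 : G (z + x) ≠ 0) :
    HasDerivAt (fun x : ℝ => Real.log ‖G (z + x)‖) (deriv G (z + x) / G (z + x)).re x := by
  have h1 : HasDerivAt (fun x : ℝ => z + (x : ℂ)) 1 x :=
    ((hasDerivAt_id x).ofReal_comp).const_add z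
  have h2 := (hG.differentiable (z + x)).hasDerivAt.comp x h1
  rw [mul_one] at h2
  exact h2.log_norm h0

lemma hasDerivAt_log_norm_add_sub (hG : IsXiQuotient γ G) {z : ℂ} (h0 : G z ≠ 0) :
    HasDerivAt (fun x : ℝ => Real.log ‖G (z + x)‖ - Real.log ‖G (z - x)‖)
      (2 * (deriv G z / G z).re) 0 := by
  have h1 := hG.hasDerivAt_log_norm_add z 0 (by simpa)
  simp only [ofReal_zero, add_zero] at h1
  have h2 := HasDerivAt.scomp (0 : ℝ) (h := fun x : ℝ => -x)
    (g₁ := fun x : ℝ => Real.log ‖G (z + x)‖) (by simpa using h1) (hasDerivAt_neg (0 : ℝ))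
  refine (h1.sub h2).congr_deriv ?_ |>.congr_of_eventuallyEq (.of_forall fun x => ?_)
  · simp
    ring
  · simp [sub_eq_add_neg]

/-- log |G(z+x)| - log |G(z-x)| vanishes at x = 0 and is nonnegative for small x > 0; its derivative
at 0 is 2 Re G'/G. -/
lemma zero_le_re_logDeriv (hRH : RiemannHypothesis) (hG : IsXiQuotient γ G) {z : ℂ}
    (hz : 0 < z.re) : 0 ≤ (deriv G z / G z).re := by
  have h0 := hG.ne_zero hRH hz
  have h1 := (hG.hasDerivAt_log_norm_add_sub h0).nonneg_of_forall_right
    (ε := min (1 / 4) (z.re / 2)) (by positivity) fun h hh hle => by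
      have hle1 : h ≤ 1 / 4 := hle.trans (min_le_left _ _)
      have hle2 : h ≤ z.re / 2 := hle.trans (min_le_right _ _)
      have hpos : 0 < ‖G (z - h)‖ :=
        norm_pos_iff.mpr (hG.ne_zero hRH (by simp; linarith))
      have := Real.log_le_log hpos (hG.norm_sub_le_norm_add hRH hh hle1 hz.le)
      simpa using this
  linarith

/-- On the axis the same difference vanishes identically, by reflection symmetry. -/
lemma re_logDeriv_eq_zero (hG : IsXiQuotient γ G) {t : ℝ} (h0 : G (t * I) ≠ 0) :
    (deriv G (t * I) / G (t * I)).re = 0 := by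
  have h1 := hG.hasDerivAt_log_norm_add_sub h0
  have h2 : (fun x : ℝ => Real.log ‖G (t * I + x)‖ - Real.log ‖G (t * I - x)‖) = fun _ => 0 := by
    ext x
    have e : (t * I - x : ℂ) = -(starRingEnd ℂ) (t * I + x) := by
      simp; ring
    rw [e, hG.norm_neg_conj, sub_self]
  rw [h2] at h1
  have := h1.unique (hasDerivAt_const (0 : ℝ) (0 : ℝ))
  linarith

lemma differentiableAt_logDeriv (hG : IsXiQuotient γ G) {z : ℂ} (h0 : G z ≠ 0) :
    DifferentiableAt ℂ (fun z => deriv G z / G z) z :=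
  (hG.differentiable.deriv z).div (hG.differentiable z) h0

/-- Along a horizontal ray from the axis, Re G'/G starts at 0 and stays nonnegative. -/
lemma zero_le_re_deriv_logDeriv (hRH : RiemannHypothesis) (hG : IsXiQuotient γ G) {t : ℝ}
    (h0 : G (t * I) ≠ 0) : 0 ≤ (deriv (fun z => deriv G z / G z) (t * I)).re := by
  have h1 : HasDerivAt (fun x : ℝ => (t * I : ℂ) + (x : ℂ)) 1 0 :=
    ((hasDerivAt_id (0 : ℝ)).ofReal_comp).const_add _
  have h2 : HasDerivAt (fun x : ℝ => (deriv G (t * I + x) / G (t * I + x)))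
      (deriv (fun z => deriv G z / G z) (t * I)) 0 := by
    have := HasDerivAt.comp (0 : ℝ) (h₂ := fun z => deriv G z / G z)
      (h := fun x : ℝ => (t * I : ℂ) + (x : ℂ))
      (h₂' := deriv (fun z => deriv G z / G z) (t * I))
      (by rw [ofReal_zero, add_zero]; exact (hG.differentiableAt_logDeriv h0).hasDerivAt) h1
    simpa [Function.comp_def] using this
  have h3 : HasDerivAt (fun x : ℝ => (deriv G (t * I + x) / G (t * I + x)).re)
      (deriv (fun z => deriv G z / G z) (t * I)).re 0 := by
    exact reCLM.hasFDerivAt.comp_hasDerivAt (0 : ℝ) h2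
  refine h3.nonneg_of_forall_right one_pos fun h hh _ => ?_
  simp only [ofReal_zero, add_zero, zero_add]
  rw [hG.re_logDeriv_eq_zero h0]
  exact hG.zero_le_re_logDeriv hRH (by simpa)

/-- On the imaginary axis, `log ‖G‖` is concave between zeros. -/
theorem concaveOn_log_norm (hRH : RiemannHypothesis) (hG : IsXiQuotient γ G) {a b : ℝ}
    (h0 : ∀ t ∈ Ioo a b, G (t * I) ≠ 0) :
    ConcaveOn ℝ (Ioo a b) fun t : ℝ => Real.log ‖G (t * I)‖ := by
  have hI (t : ℝ) : HasDerivAt (fun t : ℝ => (t * I : ℂ)) I t := by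
    simpa using ((hasDerivAt_id t).ofReal_comp).mul_const I
  have h1 : ∀ t ∈ Ioo a b, HasDerivAt (fun t : ℝ => Real.log ‖G (t * I)‖)
      (deriv G (t * I) / G (t * I) * I).re t := by
    intro t ht
    refine (((hG.differentiable (t * I)).hasDerivAt.comp t (hI t)).log_norm (h0 t ht)).congr_deriv
      ?_
    rw [mul_div_right_comm]
    rfl
  have h2 : ∀ t ∈ Ioo a b, HasDerivAt (fun t : ℝ => (deriv G (t * I) / G (t * I) * I).re)
      (-(deriv (fun z => deriv G z / G z) (t * I)).re) t := by
    intro t ht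
    have := ((hG.differentiableAt_logDeriv (h0 t ht)).hasDerivAt.comp t (hI t)).mul_const I
    have h3 := reCLM.hasFDerivAt.comp_hasDerivAt t this
    refine h3.congr_deriv ?_
    simp [mul_assoc]
  refine concaveOn_of_hasDerivWithinAt2_nonpos (convex_Ioo a b)
    (fun t ht => (h1 t ht).continuousAt.continuousWithinAt)
    (fun t ht => (h1 t (interior_subset ht)).hasDerivWithinAt)
    (fun t ht => (h2 t (interior_subset ht)).hasDerivWithinAt) fun t ht => ?_
  linarith [hG.zero_le_re_deriv_logDeriv hRH (h0 t (interior_subset ht))]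

end IsXiQuotient

/-! ### Concavity of the Gamma part. -/

/-- The left side is -d/dx of x/(x²+v), compared with the unit difference centred at x; the last
term absorbs the midpoint error. -/
lemma digammaTerm_le_telescope {x v : ℝ} (hx : 5 / 4 ≤ x) (hv : 0 ≤ v) :
    (x ^ 2 - v) / (x ^ 2 + v) ^ 2 ≤
      (x - 1 / 2) / ((x - 1 / 2) ^ 2 + v) - (x + 1 / 2) / ((x + 1 / 2) ^ 2 + v) +
        1 / (4 * (x ^ 2 + v) * (x ^ 2 + v - 1 / 4)) := by
  have hx2 : 25 / 16 ≤ x ^ 2 := by nlinarith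
  have e1 : (x - 1 / 2) / ((x - 1 / 2) ^ 2 + v) - (x + 1 / 2) / ((x + 1 / 2) ^ 2 + v) =
      (x ^ 2 - v - 1 / 4) / ((x ^ 2 + v) ^ 2 - (x ^ 2 - v) / 2 + 1 / 16) := by
    have a1 : (x - 1 / 2) ^ 2 + v ≠ 0 := by nlinarith
    have a2 : (x + 1 / 2) ^ 2 + v ≠ 0 := by nlinarith
    have a3 : (x ^ 2 + v) ^ 2 - (x ^ 2 - v) / 2 + 1 / 16 =
      ((x - 1 / 2) ^ 2 + v) * ((x + 1 / 2) ^ 2 + v) := by ring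
    rw [a3, div_sub_div _ _ a1 a2]
    congr 1
    ring
  rw [e1]
  generalize hr : x ^ 2 + v = r
  generalize hp : x ^ 2 - v = p
  have hr1 : 25 / 16 ≤ r := by linarith
  have hpr : p ≤ r := by linarith
  have hpr' : -r ≤ p := by linarith
  have hE : 0 < r ^ 2 - p / 2 + 1 / 16 := by nlinarith
  have hr4 : 0 < r - 1 / 4 := by linarith
  have hr0 : 0 < r := by linarith
  rw [← sub_nonneg]
  -- In r = x² + v and p = x² - v the claim becomes nonnegativity of a quadratic in p.
  have key : (p - 1 / 4) / (r ^ 2 - p / 2 + 1 / 16) + 1 / (4 * r * (r - 1 / 4)) - p / r ^ 2 =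
      ((2 * r - 1 / 2) * p ^ 2 + (1 / 16 - 3 * r / 4) * p + r ^ 2 / 4 + r / 16) /
        (4 * r ^ 2 * (r - 1 / 4) * (r ^ 2 - p / 2 + 1 / 16)) := by
    rw [div_add_div _ _ hE.ne' (by positivity), div_sub_div _ _ (by positivity) (by positivity),
      div_eq_div_iff (by positivity) (by positivity)]
    ring
  rw [key]
  refine div_nonneg ?_ (by positivity)
  nlinarith [sq_nonneg (2 * p - r / 2), sq_nonneg p, mul_nonneg hr0.le (sq_nonneg (p - 1 / 4))]

/-- Each term is at most 1/(x²+v). The first is kept; the tail telescopes against 1/(x²-1/4) to at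
most 4/7. -/
lemma sum_digammaTerm_le_of_le {v : ℝ} (hv : 0 < v) (hv1 : v ≤ 49 / 48) (N : ℕ) :
    ∑ j ∈ Finset.range N, ((j + 5 / 4 : ℝ) ^ 2 - v) / ((j + 5 / 4 : ℝ) ^ 2 + v) ^ 2 ≤ 1 / v := by
  have hterm : ∀ x : ℝ, (x ^ 2 - v) / (x ^ 2 + v) ^ 2 ≤ 1 / (x ^ 2 + v) := fun x => by
    rw [div_le_div_iff₀ (by positivity) (by positivity)]
    nlinarith [sq_nonneg x, mul_pos hv (show 0 < x ^ 2 + v by positivity)]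
  rcases N with _ | N
  · simp [hv.le]
  have key : ∑ j ∈ Finset.range (N + 1),
      ((j + 5 / 4 : ℝ) ^ 2 - v) / ((j + 5 / 4 : ℝ) ^ 2 + v) ^ 2 ≤
      1 / (25 / 16 + v) + 4 / 7 - 1 / (N + 7 / 4) := by
    induction N with
    | zero =>
      have := hterm (5 / 4)
      norm_num at this ⊢
      linarith
    | succ N ih =>
      rw [Finset.sum_range_succ]
      refine (add_le_add ih (hterm _)).trans ?_
      have hN : (0 : ℝ) ≤ N := N.cast_nonneg
      have : 1 / (((N + 1 : ℕ) + 5 / 4 : ℝ) ^ 2 + v) ≤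
          1 / (N + 7 / 4) - 1 / ((N + 1 : ℕ) + 7 / 4) := by
        rw [div_sub_div _ _ (by positivity) (by positivity),
          div_le_div_iff₀ (by positivity) (by positivity)]
        push_cast
        nlinarith
      linarith
  have h2 : 0 < 1 / (N + 7 / 4 : ℝ) := by positivity
  have h3 : 1 / (25 / 16 + v) + 4 / 7 ≤ 1 / v := by
    rw [div_add_div _ _ (by positivity) (by norm_num), div_le_div_iff₀ (by positivity) hv]
    nlinarith
  linarith

/-- The main terms telescope to at most (3/4)/v. The corrections add at most (1/(4v))(3/7 + 4/7),
where 3/7 for the first one is exactly the condition v ≥ 49/48. -/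
lemma sum_digammaTerm_le_of_ge {v : ℝ} (hv : 49 / 48 ≤ v) (N : ℕ) :
    ∑ j ∈ Finset.range N, ((j + 5 / 4 : ℝ) ^ 2 - v) / ((j + 5 / 4 : ℝ) ^ 2 + v) ^ 2 ≤ 1 / v := by
  have hv0 : 0 < v := by linarith
  have hcorr : ∀ x : ℝ, 5 / 4 ≤ x → 1 / (4 * (x ^ 2 + v) * (x ^ 2 + v - 1 / 4)) ≤
      1 / (4 * v) * (1 / (x ^ 2 + v - 1 / 4)) := fun x hx => by
    rw [← one_div_mul_one_div]
    have : 0 < x ^ 2 + v - 1 / 4 := by nlinarith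
    gcongr
    nlinarith
  rcases N with _ | N
  · simp [hv0.le]
  have key : ∑ j ∈ Finset.range (N + 1),
      ((j + 5 / 4 : ℝ) ^ 2 - v) / ((j + 5 / 4 : ℝ) ^ 2 + v) ^ 2 ≤
      (3 / 4) / ((3 / 4) ^ 2 + v) - (N + 7 / 4) / ((N + 7 / 4) ^ 2 + v) +
        1 / (4 * v) * (1 - 1 / (N + 7 / 4)) := by
    induction N with
    | zero =>
      have h1 := digammaTerm_le_telescope (x := 5 / 4) le_rfl hv0.le
      have h2 := hcorr (5 / 4) le_rfl
      have h3 : 1 / (4 * v) * (1 / ((5 / 4) ^ 2 + v - 1 / 4)) ≤ 1 / (4 * v) * (3 / 7) := by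
        refine mul_le_mul_of_nonneg_left ?_ (by positivity)
        rw [div_le_div_iff₀ (by linarith) (by norm_num)]
        linarith
      norm_num at h1 h2 h3 ⊢
      linarith
    | succ N ih =>
      rw [Finset.sum_range_succ]
      have hN : (0 : ℝ) ≤ N := N.cast_nonneg
      have h1 := digammaTerm_le_telescope (x := (N + 1 : ℕ) + 5 / 4) (v := v)
        (by push_cast; linarith) hv0.le
      have h2 := hcorr ((N + 1 : ℕ) + 5 / 4) (by push_cast; linarith)
      have h3 : 1 / (((N + 1 : ℕ) + 5 / 4 : ℝ) ^ 2 + v - 1 / 4) ≤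
          1 / (N + 7 / 4) - 1 / ((N + 1 : ℕ) + 7 / 4) := by
        rw [div_sub_div _ _ (by positivity) (by positivity), div_le_div_iff₀ _ (by positivity)]
        · push_cast
          nlinarith
        · push_cast
          nlinarith
      have h4 := mul_le_mul_of_nonneg_left h3 (show 0 ≤ 1 / (4 * v) by positivity)
      have e1 : ((N + 1 : ℕ) + 5 / 4 - 1 / 2 : ℝ) = N + 7 / 4 := by push_cast; ring
      have e2 : ((N + 1 : ℕ) + 5 / 4 + 1 / 2 : ℝ) = (N + 1 : ℕ) + 7 / 4 := by push_cast; ring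
      rw [e1, e2] at h1
      linarith
  have h2 : 0 ≤ 1 / (4 * v) * (1 / (N + 7 / 4 : ℝ)) := by positivity
  have h3 : (0 : ℝ) ≤ (N + 7 / 4) / ((N + 7 / 4) ^ 2 + v) := by positivity
  have h4 : (3 / 4) / ((3 / 4) ^ 2 + v) ≤ (3 / 4) / v := by
    gcongr
    norm_num
  have h5 : (3 / 4) / v + 1 / (4 * v) = 1 / v := by field_simp; norm_num
  linarith

lemma sum_digammaTerm_le {v : ℝ} (hv : 0 < v) (N : ℕ) :
    ∑ j ∈ Finset.range N, ((j + 5 / 4 : ℝ) ^ 2 - v) / ((j + 5 / 4 : ℝ) ^ 2 + v) ^ 2 ≤ 1 / v :=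
  (le_total v (49 / 48)).elim (sum_digammaTerm_le_of_le hv · N) (sum_digammaTerm_le_of_ge · N)

/-- With v = t²/4 the second derivative is a quarter of the sum in `sum_digammaTerm_le` minus 1/v.
-/
lemma concaveOn_log_add_sum_log (N : ℕ) :
    ConcaveOn ℝ (Ioi 0) fun t : ℝ => Real.log t +
      ∑ j ∈ Finset.range N, 1 / 2 * Real.log ((j + 5 / 4) ^ 2 + t ^ 2 / 4) := by
  have h1 : ∀ t ∈ Ioi (0 : ℝ), HasDerivAt (fun t : ℝ => Real.log t +
      ∑ j ∈ Finset.range N, 1 / 2 * Real.log ((j + 5 / 4) ^ 2 + t ^ 2 / 4))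
      (t⁻¹ + ∑ j ∈ Finset.range N, 1 / 4 * (t / ((j + 5 / 4) ^ 2 + t ^ 2 / 4))) t := by
    intro t ht
    refine (Real.hasDerivAt_log (ne_of_gt ht)).add (HasDerivAt.fun_sum fun j _ => ?_)
    have hp : (j + 5 / 4 : ℝ) ^ 2 + t ^ 2 / 4 ≠ 0 := by positivity
    refine ((((hasDerivAt_pow 2 t).div_const 4).const_add _ |>.log hp).const_mul
      (1 / 2)).congr_deriv ?_
    field_simp
    norm_num
  have h2 : ∀ t ∈ Ioi (0 : ℝ), HasDerivAt
      (fun t : ℝ => t⁻¹ + ∑ j ∈ Finset.range N, 1 / 4 * (t / ((j + 5 / 4) ^ 2 + t ^ 2 / 4)))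
      (-(t ^ 2)⁻¹ + ∑ j ∈ Finset.range N,
        1 / 4 * (((j + 5 / 4) ^ 2 - t ^ 2 / 4) / ((j + 5 / 4) ^ 2 + t ^ 2 / 4) ^ 2)) t := by
    intro t ht
    refine (hasDerivAt_inv (ne_of_gt ht)).add (HasDerivAt.fun_sum fun j _ => ?_)
    have hp : (j + 5 / 4 : ℝ) ^ 2 + t ^ 2 / 4 ≠ 0 := by positivity
    refine (((hasDerivAt_id t).div (((hasDerivAt_pow 2 t).div_const 4).const_add _) hp).const_mul
      (1 / 4)).congr_deriv ?_
    simp only [id]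
    congr 2
    push_cast
    ring
  refine concaveOn_of_hasDerivWithinAt2_nonpos (convex_Ioi 0)
    (fun t ht => (h1 t ht).continuousAt.continuousWithinAt)
    (fun t ht => (h1 t (interior_subset ht)).hasDerivWithinAt)
    (fun t ht => (h2 t (interior_subset ht)).hasDerivWithinAt) fun t ht => ?_
  have ht0 : 0 < t := interior_subset ht
  have := sum_digammaTerm_le (v := t ^ 2 / 4) (by positivity) N
  rw [← Finset.mul_sum]
  have e : 1 / (t ^ 2 / 4) = 4 * (t ^ 2)⁻¹ := by field_simp
  rw [e] at this
  linarith

lemma log_norm_GammaSeq_quarter (t : ℝ) {n : ℕ} (hn : n ≠ 0) :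
    Real.log ‖GammaSeq (1 / 4 + (t / 2 : ℝ) * I) n‖ = 1 / 4 * Real.log n + Real.log n.factorial -
      (∑ j ∈ Finset.range n, 1 / 2 * Real.log ((j + 5 / 4) ^ 2 + t ^ 2 / 4)) -
      1 / 2 * Real.log (1 / 16 + t ^ 2 / 4) := by
  have hn0 : (0 : ℝ) < n := by positivity
  have hne : ∀ j : ℕ, (1 / 4 + (t / 2 : ℝ) * I + j : ℂ) ≠ 0 := fun j h =>
    quarter_ne_neg_nat t j (eq_neg_of_add_eq_zero_left h)
  have hlog : ∀ j : ℕ, Real.log ‖(1 / 4 + (t / 2 : ℝ) * I + j : ℂ)‖ =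
      1 / 2 * Real.log ((j + 1 / 4) ^ 2 + t ^ 2 / 4) := by
    intro j
    have : ‖(1 / 4 + (t / 2 : ℝ) * I + j : ℂ)‖ ^ 2 = (j + 1 / 4) ^ 2 + t ^ 2 / 4 := by
      rw [← normSq_eq_norm_sq, normSq_apply]
      simp
      ring
    rw [← this, Real.log_pow]
    push_cast
    ring
  have hcp : ‖(n : ℂ) ^ (1 / 4 + (t / 2 : ℝ) * I : ℂ)‖ = (n : ℝ) ^ (1 / 4 : ℝ) := by
    rw [norm_natCast_cpow_of_pos (Nat.pos_of_ne_zero hn)]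
    simp
  rw [GammaSeq, norm_div, norm_mul, norm_prod, hcp, norm_natCast,
    Real.log_div (by positivity) (Finset.prod_ne_zero_iff.mpr fun j _ => norm_ne_zero_iff.mpr (hne j)),
    Real.log_mul (by positivity) (by positivity), Real.log_rpow hn0,
    Real.log_prod (fun j _ => norm_ne_zero_iff.mpr (hne j)), Finset.sum_range_succ']
  simp only [hlog]
  have e : ∀ j : ℕ, (((j + 1 : ℕ) : ℝ) + 1 / 4) = j + 5 / 4 := fun j => by push_cast; ring
  simp only [e]
  norm_num
  ring

lemma concaveOn_of_tendsto {ι : Type*} {l : Filter ι} [l.NeBot] {s : Set ℝ} {F : ι → ℝ → ℝ}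
    {f : ℝ → ℝ} (hs : Convex ℝ s) (hF : ∀ᶠ i in l, ConcaveOn ℝ s (F i))
    (hlim : ∀ x ∈ s, Filter.Tendsto (fun i => F i x) l (nhds (f x))) : ConcaveOn ℝ s f := by
  refine ⟨hs, fun x hx y hy a b ha hb hab => ?_⟩
  refine le_of_tendsto_of_tendsto (((hlim x hx).const_smul a).add ((hlim y hy).const_smul b))
    (hlim _ (hs hx hy ha hb hab)) ?_
  filter_upwards [hF] with i hi
  exact hi.2 hx hy ha hb hab

/-- In Euler's limit for Γ the subtracted logarithm cancels the j = 0 factor, so the remaining sum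
starts at 5/4; concavity survives pointwise limits. -/
lemma concaveOn_log_sub_log_norm_Gamma :
    ConcaveOn ℝ (Ioi 0) fun t : ℝ => Real.log t - Real.log ‖Gamma (1 / 4 + (t / 2 : ℝ) * I)‖ -
      1 / 2 * Real.log (1 / 16 + t ^ 2 / 4) := by
  refine concaveOn_of_tendsto (l := Filter.atTop) (F := fun (n : ℕ) t => Real.log t +
      (∑ j ∈ Finset.range n, 1 / 2 * Real.log ((j + 5 / 4) ^ 2 + t ^ 2 / 4)) +
      (-(1 / 4 * Real.log n + Real.log n.factorial)))
    (convex_Ioi 0) (.of_forall fun n => (concaveOn_log_add_sum_log n).add_const _) fun t ht => ?_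
  have h1 := GammaSeq_tendsto_Gamma (1 / 4 + (t / 2 : ℝ) * I)
  have h2 := h1.norm.log (norm_ne_zero_iff.mpr (Gamma_ne_zero (quarter_ne_neg_nat t)))
  refine ((h2.const_sub (Real.log t)).sub_const (1 / 2 * Real.log (1 / 16 + t ^ 2 / 4))).congr' ?_
  filter_upwards [Filter.eventually_ne_atTop 0] with n hn
  rw [log_norm_GammaSeq_quarter t hn]
  ring

/-! ### The elementary part. -/

lemma strictConcaveOn_log_sq_sub_sq {γ : ℝ} (hγ : 0 < γ) :
    StrictConcaveOn ℝ (Ioi γ) fun t : ℝ => Real.log (t ^ 2 - γ ^ 2) -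
      1 / 2 * Real.log (t ^ 2 + 1 / 4) - Real.log t := by
  have h1 : ∀ t ∈ Ioi γ, HasDerivAt (fun t : ℝ => Real.log (t ^ 2 - γ ^ 2) -
      1 / 2 * Real.log (t ^ 2 + 1 / 4) - Real.log t)
      (2 * t / (t ^ 2 - γ ^ 2) - t / (t ^ 2 + 1 / 4) - t⁻¹) t := by
    intro t (ht : γ < t)
    have hp : t ^ 2 - γ ^ 2 ≠ 0 := by nlinarith
    have hq : t ^ 2 + 1 / 4 ≠ 0 := by positivity
    refine ((((hasDerivAt_pow 2 t).sub_const _).log hp).sub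
      ((((hasDerivAt_pow 2 t).add_const _).log hq).const_mul (1 / 2)) |>.sub
      (Real.hasDerivAt_log (by linarith))).congr_deriv ?_
    push_cast
    ring
  have h2 : ∀ t ∈ Ioi γ, HasDerivAt
      (fun t => 2 * t / (t ^ 2 - γ ^ 2) - t / (t ^ 2 + 1 / 4) - t⁻¹)
      (-(2 * (t ^ 2 + γ ^ 2) / (t ^ 2 - γ ^ 2) ^ 2) -
        (1 / 4 - t ^ 2) / (t ^ 2 + 1 / 4) ^ 2 + (t ^ 2)⁻¹) t := by
    intro t (ht : γ < t)
    have hp : t ^ 2 - γ ^ 2 ≠ 0 := by nlinarith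
    have hq : t ^ 2 + 1 / 4 ≠ 0 := by positivity
    refine ((((hasDerivAt_id t).const_mul 2).div ((hasDerivAt_pow 2 t).sub_const _) hp).sub
      ((hasDerivAt_id t).div ((hasDerivAt_pow 2 t).add_const _) hq) |>.sub
      (hasDerivAt_inv (by linarith))).congr_deriv ?_
    simp only [id]
    push_cast
    ring
  have hneg : ∀ t ∈ Ioi γ, -(2 * (t ^ 2 + γ ^ 2) / (t ^ 2 - γ ^ 2) ^ 2) -
        (1 / 4 - t ^ 2) / (t ^ 2 + 1 / 4) ^ 2 + (t ^ 2)⁻¹ < 0 := by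
    intro t (ht : γ < t)
    have ht0 : 0 < t := by linarith
    have hp : 0 < t ^ 2 - γ ^ 2 := by nlinarith
    -- The zeros ±γ supply -2/t², against 1/t² from -log t and strictly less than 1/t² from the
    -- remaining logarithm (`a2`).
    have a1 : 2 * (t ^ 2)⁻¹ ≤ 2 * (t ^ 2 + γ ^ 2) / (t ^ 2 - γ ^ 2) ^ 2 := by
      rw [← div_eq_mul_inv, div_le_div_iff₀ (by positivity) (by positivity)]
      nlinarith [sq_nonneg (t * γ), sq_nonneg (γ ^ 2), mul_pos hp (sq_pos_of_pos hγ)]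
    have a2 : -((1 / 4 - t ^ 2) / (t ^ 2 + 1 / 4) ^ 2) < (t ^ 2)⁻¹ := by
      rw [← neg_div, ← one_div, div_lt_div_iff₀ (by positivity) (by positivity)]
      nlinarith [sq_pos_of_pos ht0]
    linarith
  refine StrictAntiOn.strictConcaveOn_of_deriv (convex_Ioi γ)
    (fun t ht => (h1 t ht).continuousAt.continuousWithinAt) ?_
  rw [interior_Ioi]
  refine StrictAntiOn.congr (f₁ := fun t => 2 * t / (t ^ 2 - γ ^ 2) - t / (t ^ 2 + 1 / 4) - t⁻¹) ?_
    fun t ht => (h1 t ht).deriv.symm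
  refine strictAntiOn_of_deriv_neg (convex_Ioi γ)
    (fun t ht => (h2 t ht).continuousAt.continuousWithinAt) fun t ht => ?_
  rw [(h2 t (interior_subset ht)).deriv]
  exact hneg t (interior_subset ht)

/-! ### Decomposition of log |Z| and conclusion. -/

lemma differentiable_riemannSiegelTheta : Differentiable ℝ riemannSiegelTheta := by
  have hc : Continuous fun u : ℝ => (digamma (1 / 4 + (u / 2 : ℝ) * I)).re / 2 :=
    (continuous_re.comp continuous_digamma_quarter).div_const 2
  intro t
  refine DifferentiableAt.sub ?_ (by fun_prop)
  exact (intervalIntegral.integral_hasDerivAt_right (hc.intervalIntegrable _ _)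
    (hc.stronglyMeasurableAtFilter _ _) hc.continuousAt).differentiableAt

lemma half_add_mul_I_ne_one (t : ℝ) : (1 / 2 + t * I : ℂ) ≠ 1 := fun h => by
  have := congrArg re h
  norm_num at this

lemma differentiable_hardyZ : Differentiable ℝ hardyZ := by
  intro t
  have h1 : HasDerivAt (fun t : ℝ => (1 / 2 + t * I : ℂ)) I t := by
    simpa using (((hasDerivAt_id t).ofReal_comp).mul_const I).const_add (1 / 2 : ℂ)
  have h2 := (differentiableAt_riemannZeta (half_add_mul_I_ne_one t)).hasDerivAt.comp t h1
  have h3 := ((differentiable_riemannSiegelTheta t).hasDerivAt.ofReal_comp.mul_const I).cexp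
  exact (reCLM.hasFDerivAt.comp_hasDerivAt t (h3.mul h2)).differentiableAt

lemma abs_hardyZ (t : ℝ) : |hardyZ t| = ‖riemannZeta (1 / 2 + t * I)‖ := by
  rw [← Real.norm_eq_abs, ← norm_real, ofReal_hardyZ, norm_mul, norm_exp_ofReal_mul_I, one_mul]

lemma norm_Gammaℝ_half_add (t : ℝ) : ‖Gammaℝ (1 / 2 + t * I)‖ =
    Real.pi ^ (-1 / 4 : ℝ) * ‖Gamma (1 / 4 + (t / 2 : ℝ) * I)‖ := by
  have e : (1 / 2 + t * I : ℂ) / 2 = 1 / 4 + (t / 2 : ℝ) * I := by push_cast; ring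
  rw [Gammaℝ_def, norm_mul, e, norm_cpow_eq_rpow_re_of_pos Real.pi_pos]
  congr 2
  simp
  norm_num

namespace IsXiQuotient

variable {γ : ℝ} {G : ℂ → ℂ}

lemma norm_mul_norm_eq (hG : IsXiQuotient γ G) {t : ℝ} (ht : γ < t) :
    (t ^ 2 - γ ^ 2) * ‖G (t * I)‖ = (t ^ 2 + 1 / 4) * ‖Gammaℝ (1 / 2 + t * I)‖ *
      ‖riemannZeta (1 / 2 + t * I)‖ := by
  have hγ := hG.pos
  have h1 := hG.eq_mul (t * I)
  rw [riemannXi_eq_mul_zeta (by simp) (half_add_mul_I_ne_one t)] at h1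
  have e1 : (1 / 2 + t * I : ℂ) * (1 / 2 + t * I - 1) = ((-(t ^ 2 + 1 / 4) : ℝ) : ℂ) := by
    push_cast
    linear_combination (t ^ 2 : ℂ) * I_sq
  have e2 : ((t * I) ^ 2 + γ ^ 2 : ℂ) = ((-(t ^ 2 - γ ^ 2) : ℝ) : ℂ) := by
    push_cast
    linear_combination (t ^ 2 : ℂ) * I_sq
  rw [e1, e2] at h1
  have h2 := congrArg norm h1
  simp only [norm_mul, norm_real, norm_neg] at h2
  rw [Real.norm_of_nonneg (by positivity), Real.norm_of_nonneg (by nlinarith)] at h2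
  exact h2.symm

/-- `Real.log` ignores sign, so the sign of Z is irrelevant. The term log(t² + 1/4) is shared
equally between the elementary and Gamma parts, and log t is moved from one to the other to make
both concave. -/
lemma log_hardyZ_eq (hG : IsXiQuotient γ G) {t : ℝ} (ht : γ < t)
    (hζ : riemannZeta (1 / 2 + t * I) ≠ 0) :
    Real.log (hardyZ t) = Real.log ‖G (t * I)‖ +
      (Real.log (t ^ 2 - γ ^ 2) - 1 / 2 * Real.log (t ^ 2 + 1 / 4) - Real.log t) +
      (Real.log t - Real.log ‖Gamma (1 / 4 + (t / 2 : ℝ) * I)‖ -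
        1 / 2 * Real.log (1 / 16 + t ^ 2 / 4)) +
      (1 / 4 * Real.log Real.pi - 1 / 2 * Real.log 4) := by
  have hγ := hG.pos
  have h := hG.norm_mul_norm_eq ht
  have hζn := norm_pos_iff.mpr hζ
  have hΓ : 0 < ‖Gamma (1 / 4 + (t / 2 : ℝ) * I)‖ :=
    norm_pos_iff.mpr (Gamma_ne_zero (quarter_ne_neg_nat t))
  have hp : 0 < t ^ 2 - γ ^ 2 := by nlinarith
  have hq : 0 < t ^ 2 + 1 / 4 := by positivity
  have hπ := Real.rpow_pos_of_pos Real.pi_pos (-1 / 4)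
  rw [norm_Gammaℝ_half_add] at h
  have hGn : ‖G (t * I)‖ ≠ 0 := fun h0 => by
    rw [h0, mul_zero] at h
    exact absurd h (by positivity)
  have hl := congrArg Real.log h
  rw [Real.log_mul hp.ne' hGn, Real.log_mul (by positivity) hζn.ne',
    Real.log_mul hq.ne' (by positivity), Real.log_mul hπ.ne' hΓ.ne',
    Real.log_rpow Real.pi_pos] at hl
  have e : 1 / 16 + t ^ 2 / 4 = (t ^ 2 + 1 / 4) / 4 := by ring
  rw [← Real.log_abs, abs_hardyZ, e, Real.log_div hq.ne' (by norm_num)]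
  linarith

end IsXiQuotient

theorem corollary1 (hRH : RiemannHypothesis) (γ₁ γ₂ : ℝ) (hpos : 0 < γ₁)
    (hγ : IsNeighboringZeros γ₁ γ₂) :
    (∀ t ∈ Ioo γ₁ γ₂, hardyZ t ≠ 0 ∧ DifferentiableAt ℝ hardyZ t) ∧
      StrictAntiOn (fun t : ℝ => deriv hardyZ t / hardyZ t) (Ioo γ₁ γ₂) := by
  have hne : ∀ t ∈ Ioo γ₁ γ₂, hardyZ t ≠ 0 := fun t ht => by
    rw [← abs_pos, abs_hardyZ, norm_pos_iff]
    exact hγ.ne_zero t ht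
  refine ⟨fun t ht => ⟨hne t ht, differentiable_hardyZ t⟩, ?_⟩
  obtain ⟨G, hG⟩ := exists_isXiQuotient hpos hγ.zero_left
  have hG0 : ∀ t ∈ Ioo γ₁ γ₂, G (t * I) ≠ 0 := fun t ht h0 => by
    have h := hG.norm_mul_norm_eq ht.1
    rw [h0, norm_zero, mul_zero] at h
    have hζ := norm_pos_iff.mpr (hγ.ne_zero t ht)
    have hΓ := norm_pos_iff.mpr (Gammaℝ_ne_zero_of_re_pos (s := 1 / 2 + t * I) (by simp))
    exact absurd h (by positivity)
  have hcv : Convex ℝ (Ioo γ₁ γ₂) := convex_Ioo γ₁ γ₂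
  have hconc : StrictConcaveOn ℝ (Ioo γ₁ γ₂) fun t => Real.log (hardyZ t) := by
    have h1 := hG.concaveOn_log_norm hRH hG0
    have h2 := (strictConcaveOn_log_sq_sub_sq hpos).subset Ioo_subset_Ioi_self hcv
    have h3 := concaveOn_log_sub_log_norm_Gamma.subset
      (fun t (ht : t ∈ Ioo γ₁ γ₂) => hpos.trans ht.1) hcv
    have h4 := (h2.add_concaveOn (h1.add h3)).add_const
      (1 / 4 * Real.log Real.pi - 1 / 2 * Real.log 4)
    refine h4.congr fun t ht => ?_
    rw [hG.log_hardyZ_eq ht.1 (hγ.ne_zero t ht)]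
    simp only [Pi.add_apply]
    ring
  have hder : ∀ t ∈ Ioo γ₁ γ₂, HasDerivAt (fun t => Real.log (hardyZ t))
      (deriv hardyZ t / hardyZ t) t := fun t ht =>
    (differentiable_hardyZ t).hasDerivAt.log (hne t ht)
  exact (hconc.strictAntiOn_deriv fun t ht => (hder t ht).differentiableAt).congr
    fun t ht => (hder t ht).deriv
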